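/- \textbf{Setting.} Let $\Omega\subset\mathbb R^2$ be a bounded simply connected polygonal domain carrying a pair of finite staggered meshes, as follows. \emph{Dual mesh.} The dual cells $D_\nu$ ($1\le\nu\le N_v$) are non-overlapping polygons (regions enclosed by simple closed polygons) contained in $\Omega$, whose closures cover $\overline\Omega$. Each $D_\nu$ contains a chosen center $y_\nu$. \emph{Primary mesh.} The primary cells $A_i$ (those on the boundary being cut off at $\partial\Omega$) are likewise non-overlapping polygons in $\Omega$ whose closures cover $\overline\Omega$. The $A_i$ have distinct centers $x_i\in\overline{A_i}$. \emph{Edge pairs.} Primary and dual edges share a common index $e$, and each index is either an interior or a boundary edge pair. The dual edge $e$ is the segment joining the centers $x_i$ of the two primary cells $i\in\mathrm{CE}(e)$. For an interior pair, the primary edge $e$ is the segment joining the centers $y_\nu$ of the two dual cells $\nu\in\mathrm{VE}(e)$; the two edges cross orthogonally at a point $p_e$ in the relative interior of both. For a boundary pair, $\mathrm{VE}(e)$ has exactly one element $\nu$, and the primary edge (its part in the domain) is the segment from $y_\nu$ to a point $p_e$ in the relative interior of the dual edge, orthogonal to the dual edge. Different dual edges, and different primary edges, meet at most in common end points that are cell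 centers, and a primary edge meets no dual edge except its own. The boundary $\partial\Omega$ is the union of the dual edges of the boundary pairs. The boundary of $D_\nu$ is the union of the dual edges $e$ with $\nu\in\mathrm{VE}(e)$. With $\mathrm{EC}(i)=\{e: i\in\mathrm{CE}(e)\}$, the boundary of $A_i$ is the union of the primary edges $e\in\mathrm{EC}(i)$ and of the segments $[x_i,p_e]$ for the boundary pairs $e\in \mathrm{EC}(i)$. \emph{Notation.} Let $l_e>0$ be the length of the primary edge $e$ and $|A_i|$ the area of $A_i$. For each $e$ fix a unit vector $\mathbf n_e$ normal to the primary edge, and let $\mathbf t_e$ be $\mathbf n_e$ rotated counterclockwise by $90^\circ$. For $i\in\mathrm{CE}(e)$ put $n_{e,i}=1$ if $\mathbf n_e$ points away from $A_i$ (that is, $\mathbf n_e\cdot(p_e-x_i)>0$) and $n_{e,i}=-1$ otherwise; for $\nu\in\mathrm{VE}(e)$ put $t_{e,\nu}=1$ if $\mathbf t_e$ points away from $D_\nu$ (that is, $\mathbf t_e\cdot(p_e-y_\nu)>0$) and $t_{e,\nu}=-1$ otherwise. \emph{Discrete fields.} A discrete vector field $u_h\in V_h$ is given by one real number $u_e$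 per edge pair ($u_h=\sum_e u_e\chi_{e}\mathbf n_e$, where $\chi_e$ is the characteristic function of the region spanned by the edge pair $e$). A discrete scalar field $\psi_h\in\Psi_h$ on the dual mesh is given by one real number $\psi_\nu$ per dual cell ($\psi_h=\sum_\nu\psi_\nu\chi_{D_\nu}$). Define $$[\nabla_h\cdot u_h]_i=\frac1{|A_i|}\sum_{e\in \mathrm{EC}(i)}u_e\,l_e\,n_{e,i},\qquad [\widetilde\nabla_h^\perp\psi_h]_e=\frac1{l_e}\sum_{\nu\in\mathrm{VE}(e)}\psi_\nu\,t_{e,\nu}.$$ \textbf{Lemma.} Let $u_h\in V_h$. Then $\nabla_h\cdot u_h=0$ (that is, $[\nabla_h\cdot u_h]_i=0$ for every primary cell $i$, including the boundary cells) if and only if there exists $\psi_h\in\Psi_h$ such that $u_h=\widetilde\nabla_h^\perp\psi_h$ (that is, $u_e=[\widetilde\nabla_h^\perp\psi_h]_e$ for every edge pair $e$, including the boundary pairs). -/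

import Mathlib

open Set MeasureTheory
open scoped BigOperators

/-- A polygon in the plane `ℂ` is simple if its (at least three) vertices are distinct and two
different edges meet at most in a common end point. -/
def Polygon.IsSimple {n : ℕ} (P : Polygon ℂ n) : Prop :=
  3 ≤ n ∧ Function.Injective P.vertices ∧
    ∀ i j : Fin n, i ≠ j → P.edgeSet ℝ i ∩ P.edgeSet ℝ j ⊆
      {P i, P (finRotate n i)} ∩ {P j, P (finRotate n j)}

/-- The region enclosed by a simple polygon: a bounded, open and connected set whose boundary
is a simple closed polygon. -/
structure IsPolygonalCell (C : Set ℂ) : Prop where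
  isOpen : IsOpen C
  isConnected : IsConnected C
  isBounded : Bornology.IsBounded C
  frontier_eq : ∃ (n : ℕ) (P : Polygon ℂ n), P.IsSimple ∧ frontier C = P.boundary ℝ

/-- The data of a pair of staggered meshes in the plane `ℂ`: a primary mesh with cells indexed
by `I`, a dual mesh with cells indexed by `N`, and edge pairs (a primary edge and the dual edge
crossing it) indexed by `E`. The laws are in `StaggeredMesh`. -/
structure MeshData (I N E : Type*) where
  /-- the part in the domain of the primary cell `A_i` (an open set) -/
  cell : I → Set ℂ
  /-- the dual cell `A_ν` (an open set) -/
  dualCell : N → Set ℂ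
  /-- the center `x_i` of the primary cell `A_i` -/
  center : I → ℂ
  /-- the center `y_ν` of the dual cell `A_ν` -/
  dualCenter : N → ℂ
  /-- `CE e`: the primary cells bordering the primary edge `e`; their centers are the end points
  of the dual edge `e` -/
  CE : E → Finset I
  /-- `VE e`: the dual cells bordering the dual edge `e`; their centers are the end points of
  the primary edge `e` in the domain -/
  VE : E → Finset N
  /-- the edge pairs on the boundary -/
  bdryEdge : Set E
  /-- the point where the primary edge `e` and the dual edge `e` intersect -/
  mid : E → ℂ
  /-- the chosen unit vector `n_e` normal to the primary edge `e` -/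
  normal : E → ℂ

namespace MeshData

variable {I N E : Type*} (M : MeshData I N E)

/-- The dual edge `e`: the segment between the centers of the two primary cells in `CE e`. -/
def dualEdge (e : E) : Set ℂ := convexHull ℝ (M.center '' (M.CE e : Set I))

/-- The primary edge `e`, or its part in the domain. In the interior it is the segment between
the centers of the two dual cells in `VE e` (and `mid e` lies on it). On the boundary it
is the segment from the center of the only dual cell in `VE e` to the point `mid e`, where the
primary edge leaves the domain. -/
def primaryEdge (e : E) : Set ℂ :=
  convexHull ℝ (insert (M.mid e) (M.dualCenter '' (M.VE e : Set N)))

/-- The length `l_e` of the primary edge `e`. -/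
noncomputable def primaryLength (e : E) : ℝ := Metric.diam (M.primaryEdge e)

/-- The area of the primary cell `i`. -/
noncomputable def cellArea (i : I) : ℝ := volume.real (M.cell i)

open Classical in
/-- The direction indicator `n_{e,i}`: it is `1` if `n_e` points away from the primary cell `i`,
and `-1` if `n_e` points towards it. -/
noncomputable def normalSign (e : E) (i : I) : ℝ :=
  if 0 < inner ℝ (M.normal e) (M.mid e - M.center i) then 1 else -1

/-- The tangent vector `t_e = k × n_e`: the vector `n_e` rotated counterclockwise by a right
angle. -/
def tangent (e : E) : ℂ := Complex.I * M.normal e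

open Classical in
/-- The direction indicator `t_{e,ν}`: it is `1` if `t_e` points away from the dual cell `ν`,
and `-1` if `t_e` points towards it. -/
noncomputable def tangentSign (e : E) (ν : N) : ℝ :=
  if 0 < inner ℝ (M.tangent e) (M.mid e - M.dualCenter ν) then 1 else -1

/-- `EV ν`: the edges whose dual edges form the boundary of the dual cell `ν`. -/
def EV (ν : N) : Set E := {e | ν ∈ M.VE e}

open Classical in
/-- `EC i`: the edges whose primary edges form the boundary (in the domain) of the
primary cell `i`. -/
noncomputable def EC [Fintype E] (i : I) : Finset E := {e | i ∈ M.CE e}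

end MeshData

/-- A pair of staggered meshes (primary and dual) on the polygonal domain `Ω`. -/
structure StaggeredMesh (Ω : Set ℂ) (I N E : Type*) [Fintype I] [Fintype N] [Fintype E]
    extends MeshData I N E where
  /-- The dual edge `e` joins the centers of two primary cells, and `mid e` lies inside it. -/
  CE_spec : ∀ e, ∃ i j, i ≠ j ∧ (CE e : Set I) = {i, j} ∧
    mid e ∈ openSegment ℝ (center i) (center j)
  /-- In the interior the primary edge `e` joins the centers of two dual cells, and
  `mid e` lies inside it. -/
  VE_interior : ∀ e ∉ bdryEdge, ∃ μ ν, μ ≠ ν ∧ (VE e : Set N) = {μ, ν} ∧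
    mid e ∈ openSegment ℝ (dualCenter μ) (dualCenter ν)
  /-- With a boundary edge only one dual cell is associated. -/
  VE_bdry : ∀ e ∈ bdryEdge, ∃ ν, (VE e : Set N) = {ν}
  /-- Primary and dual edges intersect orthogonally. -/
  orthogonal : ∀ e, ∀ i ∈ CE e, ∀ ν ∈ VE e,
    inner ℝ (center i - mid e) (dualCenter ν - mid e) = 0
  /-- `n_e` is a unit vector. -/
  norm_normal : ∀ e, ‖normal e‖ = 1
  /-- `n_e` is normal to the primary edge `e`. -/
  normal_orthogonal : ∀ e, ∀ ν ∈ VE e, inner ℝ (normal e) (dualCenter ν - mid e) = 0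
  /-- Different cells have different centers. -/
  center_injective : Function.Injective center
  /-- Different dual edges meet only in common vertices. -/
  dualEdge_inter : ∀ e e', e ≠ e' →
    toMeshData.dualEdge e ∩ toMeshData.dualEdge e' ⊆ center '' {i | i ∈ CE e ∧ i ∈ CE e'}
  /-- Different primary edges meet only in common vertices. -/
  primaryEdge_inter : ∀ e e', e ≠ e' →
    toMeshData.primaryEdge e ∩ toMeshData.primaryEdge e' ⊆
      dualCenter '' {ν | ν ∈ VE e ∧ ν ∈ VE e'}
  /-- A primary edge meets no dual edge but its own. -/
  edge_disjoint : ∀ e e', e ≠ e' →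
    Disjoint (toMeshData.primaryEdge e) (toMeshData.dualEdge e')
  /-- The boundary of the domain consists of the dual edges on the boundary. -/
  frontier_domain : frontier Ω = ⋃ e ∈ bdryEdge, toMeshData.dualEdge e
  /-- The dual cells are polygons, -/
  isPolygonalCell_dualCell : ∀ ν, IsPolygonalCell (dualCell ν)
  /-- bounded by dual edges, -/
  frontier_dualCell : ∀ ν, frontier (dualCell ν) = ⋃ e ∈ toMeshData.EV ν, toMeshData.dualEdge e
  dualCenter_mem : ∀ ν, dualCenter ν ∈ dualCell ν
  /-- they lie inside the domain, do not overlap, -/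
  dualCell_subset : ∀ ν, dualCell ν ⊆ Ω
  dualCell_disjoint : ∀ μ ν, μ ≠ ν → Disjoint (dualCell μ) (dualCell ν)
  /-- and cover it. -/
  closure_dualCell : ⋃ ν, closure (dualCell ν) = closure Ω
  /-- The primary cells (cut off at the boundary of the domain) are polygons, -/
  isPolygonalCell_cell : ∀ i, IsPolygonalCell (cell i)
  /-- bounded by primary edges and, for the cells on the boundary, by the two parts of boundary
  edges that end in the center of the cell; -/
  frontier_cell : ∀ i, frontier (cell i) =
    (⋃ e ∈ toMeshData.EC i, toMeshData.primaryEdge e) ∪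
      ⋃ e ∈ {e | e ∈ toMeshData.EC i ∧ e ∈ bdryEdge}, segment ℝ (center i) (mid e)
  center_mem : ∀ i, center i ∈ closure (cell i)
  /-- they do not overlap, -/
  cell_subset : ∀ i, cell i ⊆ Ω
  cell_disjoint : ∀ i j, i ≠ j → Disjoint (cell i) (cell j)
  /-- and cover the domain. -/
  closure_cell : ⋃ i, closure (cell i) = closure Ω

namespace StaggeredMesh

variable {Ω : Set ℂ} {I N E : Type*} [Fintype I] [Fintype N] [Fintype E]
  (M : StaggeredMesh Ω I N E)

/-- The space `Φ_h` of discrete scalar fields `∑ i, φ_i χ_{A_i}` on the primary mesh, given by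
their coefficients. -/
abbrev PrimaryScalarField (_M : StaggeredMesh Ω I N E) : Type _ := I → ℝ

/-- The space `Ψ_h` of discrete scalar fields `∑ ν, ψ_ν χ_{A_ν}` on the dual mesh, given by
their coefficients. -/
abbrev DualScalarField (_M : StaggeredMesh Ω I N E) : Type _ := N → ℝ

/-- The space `V_h` of discrete vector fields `∑ e, u_e χ_{A_e} n_e`, with `A_e` the
diamond spanned by the edge pair `e`, given by their coefficients. -/
abbrev VectorField (_M : StaggeredMesh Ω I N E) : Type _ := E → ℝ

/-- The discrete divergence `[∇_h · u]_i = (1 / |A_i|) ∑_{e ∈ EC i} u_e l_e n_{e,i}`. -/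
noncomputable def divergence (u : M.VectorField) : M.PrimaryScalarField := fun i =>
  1 / M.cellArea i * ∑ e ∈ M.EC i, u e * M.primaryLength e * M.normalSign e i

/-- The discrete skew gradient `[∇_h^⊥ ψ]_e = (1 / l_e) ∑_{ν ∈ VE e} ψ_ν t_{e,ν}`. -/
noncomputable def skewGradient (ψ : M.DualScalarField) : M.VectorField := fun e =>
  1 / M.primaryLength e * ∑ ν ∈ M.VE e, ψ ν * M.tangentSign e ν

end StaggeredMesh

/-!
The dual edges form a graph whose vertices are the primary cells (through their centers), and the
dual cells are the bounded faces of this graph. With the fluxes `f_e = u_e l_e`, the divergence of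
`u` vanishes if and only if `f` is a 1-cycle of the graph, and `u` is a skew gradient if and only if
`f` is the boundary of the 2-chain `ψ`. So the theorem says that the cell complex of the dual mesh
has vanishing first homology.

A boundary is a cycle (`StaggeredMesh.divergence_skewGradient`): near a vertex a dual cell is a
circular sector (`IsPolygonalCell.exists_inter_ball_eq_sector`), so exactly two of its edges end
there, and the cell lies to the left of one and to the right of the other.

Conversely, a cycle `f` has the winding potential
`W(z) = ∑ e, f_e log ((x_b - z) / (x_a - z))`, the sum over the dual edges `[x_a, x_b]`. Summation
by parts shows that `W' = 0` off the dual edges, so `W` is constant on each dual cell. Across the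
dual edge `e` it jumps by `2πi f_e`. Therefore `ψ = -Im W / 2π` has the prescribed differences
across the interior edges. At a boundary edge one also needs `W = 0` outside the closure of the
domain `Ω`. This is where simple connectedness enters: for `w` outside, `log (z - w)` has a
continuous branch on `Ω`, which extends to the vertices, so that the logarithms in `W(w)` are
differences of a function `θ` of the vertices and cancel on the cycle. The extension is possible
because `Ω` is locally connected at the vertices
(`StaggeredMesh.exists_isPreconnected_inter_ball`): as the primary cells are simple polygons, at
most two boundary edges meet in a vertex. A pinched domain, for which the assertion fails, is
excluded in this way.

Sides of an edge are described by thin triangles with the edge as base that avoid all dual edges.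
That a dual cell lies on one side only of each of its edges follows from the simplicity of its
boundary polygon, without the Jordan curve theorem: a cell on both sides of one edge would,
following the polygon, fill a neighbourhood of its whole boundary
(`IsPolygonalCell.closure_notMem_nhds`).
-/

section PlaneTopology
open Filter Topology

/-! ### Preconnected sets, frontiers and rays -/

theorem IsPreconnected.subset_or_disjoint_closure {X : Type*} [TopologicalSpace X] {S C : Set X}
    (hS : IsPreconnected S) (hC : IsOpen C) (h : Disjoint S (frontier C)) :
    S ⊆ C ∨ Disjoint S (closure C) := by
  have h1 : S ⊆ C ∪ (closure C)ᶜ := by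
    intro z hz
    by_cases hzC : z ∈ C
    · exact Or.inl hzC
    · refine Or.inr fun hcl => disjoint_left.1 h hz ?_
      rw [hC.frontier_eq]
      exact ⟨hcl, hzC⟩
  have h2 : Disjoint C (closure C)ᶜ := disjoint_compl_right.mono_left subset_closure
  exact (hS.subset_or_subset hC isClosed_closure.isOpen_compl h2 h1).imp id
    fun h => disjoint_left.2 fun z hz hz' => h hz hz'

theorem exists_ball_forall_mem_imp {X ι : Type*} [PseudoMetricSpace X] [Finite ι] {F : ι → Set X}
    (hF : ∀ j, IsClosed (F j)) (x : X) :
    ∃ r > 0, ∀ j, ∀ z ∈ Metric.ball x r, z ∈ F j → x ∈ F j := by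
  have : ∀ᶠ z in 𝓝 x, ∀ j, z ∈ F j → x ∈ F j := by
    rw [eventually_all]
    intro j
    by_cases hx : x ∈ F j
    · exact Eventually.of_forall fun _ _ => hx
    · filter_upwards [(hF j).isOpen_compl.mem_nhds hx] with z hz hz'
      exact absurd hz' hz
  obtain ⟨r, hr, h⟩ := Metric.eventually_nhds_iff_ball.1 this
  exact ⟨r, hr, fun j z hz => h z hz j⟩

/-- The closed ray from `x` in the direction with angle `θ`. -/
def angleRay (x : ℂ) (θ : ℝ) : Set ℂ :=
  {z | ∃ ρ : ℝ, 0 ≤ ρ ∧ z = x + ρ * Complex.exp (θ * Complex.I)}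

/-- The open circular sector with apex `x`, radius `r` and angles strictly between `α` and `β`. -/
def sector (x : ℂ) (α β r : ℝ) : Set ℂ :=
  (fun q : ℝ × ℝ => x + q.1 * Complex.exp (q.2 * Complex.I)) '' (Ioo 0 r ×ˢ Ioo α β)

theorem norm_ofReal_mul_exp_mul_I {ρ : ℝ} (hρ : 0 ≤ ρ) (θ : ℝ) :
    ‖(ρ : ℂ) * Complex.exp (θ * Complex.I)‖ = ρ := by
  rw [norm_mul, Complex.norm_exp_ofReal_mul_I, mul_one, Complex.norm_real, Real.norm_of_nonneg hρ]

theorem isPreconnected_sector (x : ℂ) (α β r : ℝ) : IsPreconnected (sector x α β r) :=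
  (isPreconnected_Ioo.prod isPreconnected_Ioo).image _ (by fun_prop)

theorem sector_subset_ball (x : ℂ) (α β r : ℝ) : sector x α β r ⊆ Metric.ball x r := by
  rintro _ ⟨⟨ρ, θ⟩, ⟨hρ, -⟩, rfl⟩
  simpa [abs_of_pos hρ.1] using hρ.2

theorem mem_closure_sector (x : ℂ) {α β r ρ θ : ℝ} (hαβ : α < β) (hr : 0 < r) (hρ : ρ ∈ Icc 0 r)
    (hθ : θ ∈ Icc α β) : x + ρ * Complex.exp (θ * Complex.I) ∈ closure (sector x α β r) := by
  have hc : Continuous (fun q : ℝ × ℝ => x + q.1 * Complex.exp (q.2 * Complex.I)) := by fun_prop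
  refine image_closure_subset_closure_image hc ⟨(ρ, θ), ?_, rfl⟩
  rw [closure_prod_eq, closure_Ioo hr.ne, closure_Ioo hαβ.ne]
  exact ⟨hρ, hθ⟩

theorem exists_angle (w : ℂ) (α : ℝ) :
    ∃ θ ∈ Ico α (α + 2 * Real.pi), w = ‖w‖ * Complex.exp (θ * Complex.I) := by
  refine ⟨toIcoMod Real.two_pi_pos α w.arg, toIcoMod_mem_Ico _ _ _, ?_⟩
  rw [toIcoMod]
  push_cast
  conv_lhs => rw [← Complex.norm_mul_exp_arg_mul_I w]
  congr 1
  rw [Complex.exp_eq_exp_iff_exists_int]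
  exact ⟨toIcoDiv Real.two_pi_pos α w.arg, by simp; ring⟩

theorem mem_sector_or_mem_sector_or_mem_ray {x z : ℂ} {α β r : ℝ} (hz : z ∈ Metric.ball x r) :
    z ∈ sector x α β r ∨ z ∈ sector x β (α + 2 * Real.pi) r ∨ z ∈ angleRay x α ∪ angleRay x β := by
  obtain ⟨θ, hθ, h⟩ := exists_angle (z - x) α
  have hzr : ‖z - x‖ < r := by simpa [dist_eq_norm] using hz
  have hz' : x + ‖z - x‖ * Complex.exp (θ * Complex.I) = z := by rw [← h]; ring
  by_cases h0 : ‖z - x‖ = 0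
  · right; right; left
    exact ⟨0, le_rfl, by rw [norm_eq_zero, sub_eq_zero] at h0; simp [h0]⟩
  have hpos : 0 < ‖z - x‖ := lt_of_le_of_ne (norm_nonneg _) (Ne.symm h0)
  rcases eq_or_lt_of_le hθ.1 with rfl | h1
  · right; right; left
    exact ⟨_, norm_nonneg _, hz'.symm⟩
  rcases lt_trichotomy θ β with h2 | rfl | h2
  · left
    exact ⟨(‖z - x‖, θ), ⟨⟨hpos, hzr⟩, h1, h2⟩, hz'⟩
  · right; right; right
    exact ⟨_, norm_nonneg _, hz'.symm⟩
  · right; left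
    exact ⟨(‖z - x‖, θ), ⟨⟨hpos, hzr⟩, h2, hθ.2⟩, hz'⟩

theorem angleRay_add_two_pi (x : ℂ) (α : ℝ) : angleRay x (α + 2 * Real.pi) = angleRay x α := by
  have : Complex.exp (((α + 2 * Real.pi : ℝ) : ℂ) * Complex.I) = Complex.exp (α * Complex.I) := by
    push_cast
    rw [add_mul, Complex.exp_add, Complex.exp_two_pi_mul_I, mul_one]
  simp only [angleRay, this]

/-- A point of two rays bounding two complementary sectors lies in the closure of both sectors. -/
theorem mem_closure_sectors {x z : ℂ} {α β r : ℝ} (hαβ : α < β) (hβ : β < α + 2 * Real.pi)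
    (hz : z ∈ Metric.ball x r) (hray : z ∈ angleRay x α ∪ angleRay x β) :
    z ∈ closure (sector x α β r) ∧ z ∈ closure (sector x β (α + 2 * Real.pi) r) := by
  have hr : 0 < r := Metric.pos_of_mem_ball hz
  have key : ∀ θ : ℝ, z ∈ angleRay x θ →
      ∃ ρ ∈ Icc 0 r, z = x + ρ * Complex.exp (θ * Complex.I) := by
    rintro θ ⟨ρ, hρ, rfl⟩
    refine ⟨ρ, ⟨hρ, ?_⟩, rfl⟩
    simp [abs_of_nonneg hρ] at hz
    exact hz.le
  rcases hray with h | h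
  · constructor
    · obtain ⟨ρ, hρ, rfl⟩ := key _ h
      exact mem_closure_sector x hαβ hr hρ ⟨le_rfl, hαβ.le⟩
    · rw [← angleRay_add_two_pi] at h
      obtain ⟨ρ, hρ, rfl⟩ := key _ h
      exact mem_closure_sector x hβ hr hρ ⟨hβ.le, le_rfl⟩
  · obtain ⟨ρ, hρ, rfl⟩ := key _ h
    exact ⟨mem_closure_sector x hαβ hr hρ ⟨hαβ.le, le_rfl⟩,
      mem_closure_sector x hβ hr hρ ⟨le_rfl, hβ.le⟩⟩

theorem angle_eq_of_mem_sector_of_mem_angleRay {x z : ℂ} {α β r γ : ℝ}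
    (hz : z ∈ sector x α β r) (hγ : z ∈ angleRay x γ) :
    ∃ n : ℤ, α < γ + n * (2 * Real.pi) ∧ γ + n * (2 * Real.pi) < β := by
  obtain ⟨⟨ρ, θ⟩, ⟨hρ, hθ⟩, rfl⟩ := hz
  obtain ⟨ρ', hρ', h⟩ := hγ
  have h1 := add_left_cancel h
  dsimp only at hρ hθ h1
  have h2 : ρ = ρ' := by
    rw [← norm_ofReal_mul_exp_mul_I hρ.1.le θ, h1, norm_ofReal_mul_exp_mul_I hρ' γ]
  subst h2
  have h3 := mul_left_cancel₀ (Complex.ofReal_ne_zero.2 hρ.1.ne') h1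
  obtain ⟨n, hn⟩ := Complex.exp_eq_exp_iff_exists_int.1 h3
  refine ⟨n, ?_⟩
  have : θ = γ + n * (2 * Real.pi) := by
    have := congrArg Complex.im hn
    simpa using this
  rw [← this]
  exact hθ

theorem disjoint_sector_angleRay {x : ℂ} {α β r : ℝ} (hαβ : α < β) (hβ : β < α + 2 * Real.pi) :
    Disjoint (sector x α β r) (angleRay x α ∪ angleRay x β) := by
  have hπ := Real.two_pi_pos
  refine disjoint_left.2 fun z hz hray => ?_
  rcases hray with h | h
  · obtain ⟨n, h1, h2⟩ := angle_eq_of_mem_sector_of_mem_angleRay hz h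
    have h3 : (0 : ℝ) < n := by nlinarith
    have h4 : (1 : ℝ) ≤ n := by exact_mod_cast h3
    nlinarith
  · obtain ⟨n, h1, h2⟩ := angle_eq_of_mem_sector_of_mem_angleRay hz h
    have h3 : (n : ℝ) < 0 := by nlinarith
    have h4 : (n : ℝ) ≤ -1 := by
      have : n < 0 := by exact_mod_cast h3
      exact_mod_cast Int.le_sub_one_of_lt this
    nlinarith

theorem disjoint_sector_frontier {C : Set ℂ} {x : ℂ} {α β r : ℝ}
    (hαβ : α < β) (hβ : β < α + 2 * Real.pi)
    (hfr : frontier C ∩ Metric.ball x r ⊆ angleRay x α ∪ angleRay x β) :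
    Disjoint (sector x α β r) (frontier C) ∧
      Disjoint (sector x β (α + 2 * Real.pi) r) (frontier C) := by
  constructor
  · refine disjoint_left.2 fun z hz hzC => disjoint_left.1 (disjoint_sector_angleRay hαβ hβ) hz ?_
    exact hfr ⟨hzC, sector_subset_ball _ _ _ _ hz⟩
  · refine disjoint_left.2 fun z hz hzC => disjoint_left.1
      (disjoint_sector_angleRay hβ (by linarith : α + 2 * Real.pi < β + 2 * Real.pi)) hz ?_
    rw [angleRay_add_two_pi, union_comm]
    exact hfr ⟨hzC, sector_subset_ball _ _ _ _ hz⟩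

/-- If near `x` the frontier of an open set lies on two rays, and the closure of the set is a
neighbourhood of some point near `x` of the two rays, then both sectors are filled. -/
theorem ball_subset_closure_of_mem_nhds {C : Set ℂ} (hC : IsOpen C) {x q : ℂ} {α β r : ℝ}
    (hαβ : α < β) (hβ : β < α + 2 * Real.pi)
    (hfr : frontier C ∩ Metric.ball x r ⊆ angleRay x α ∪ angleRay x β)
    (hq : q ∈ Metric.ball x r) (hqray : q ∈ angleRay x α ∪ angleRay x β) (hqC : closure C ∈ 𝓝 q) :
    Metric.ball x r ⊆ closure C := by
  obtain ⟨hq1, hq2⟩ := mem_closure_sectors hαβ hβ hq hqray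
  have key : ∀ S : Set ℂ, IsPreconnected S → Disjoint S (frontier C) → q ∈ closure S → S ⊆ C := by
    intro S hS hd hqS
    refine (hS.subset_or_disjoint_closure hC hd).resolve_right fun h => ?_
    obtain ⟨y, hy1, hy2⟩ := mem_closure_iff_nhds.1 hqS _ hqC
    exact disjoint_left.1 h hy2 hy1
  have h1 := key _ (isPreconnected_sector x α β r)
    (disjoint_sector_frontier hαβ hβ hfr).1 hq1
  have h2 := key _ (isPreconnected_sector x β (α + 2 * Real.pi) r)
    (disjoint_sector_frontier hαβ hβ hfr).2 hq2
  intro z hz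
  rcases mem_sector_or_mem_sector_or_mem_ray hz (α := α) (β := β) with h | h | h
  · exact subset_closure (h1 h)
  · exact subset_closure (h2 h)
  · exact closure_mono h1 (mem_closure_sectors hαβ hβ hz h).1

/-- Near a point `x` of its closure, an open set that is locally bounded by two rays and does not
fill a neighbourhood of `x` up to closure is a sector. -/
theorem exists_inter_ball_eq_sector {C : Set ℂ} (hC : IsOpen C) {x : ℂ} {α β r : ℝ} (hr : 0 < r)
    (hx : x ∈ closure C) (hαβ : α < β) (hβ : β < α + 2 * Real.pi)
    (hfr : frontier C ∩ Metric.ball x r ⊆ angleRay x α ∪ angleRay x β)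
    (hnot : ¬ Metric.ball x r ⊆ closure C) :
    ∃ α' β' : ℝ, α' < β' ∧ β' < α' + 2 * Real.pi ∧
      frontier C ∩ Metric.ball x r ⊆ angleRay x α' ∪ angleRay x β' ∧
      C ∩ Metric.ball x r = sector x α' β' r := by
  obtain ⟨hd1, hd2⟩ := disjoint_sector_frontier hαβ hβ hfr
  have h1 := (isPreconnected_sector x α β r).subset_or_disjoint_closure hC hd1
  have h2 := (isPreconnected_sector x β (α + 2 * Real.pi) r).subset_or_disjoint_closure hC hd2
  -- a sector that misses the closure of `C` keeps `C` off both rays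
  have hray : ∀ S : Set ℂ, Disjoint S (closure C) → ∀ z ∈ closure S, z ∉ C := by
    intro S hS z hz hzC
    obtain ⟨y, hy1, hy2⟩ := mem_closure_iff_nhds.1 hz _ (hC.mem_nhds hzC)
    exact disjoint_left.1 hS hy2 (subset_closure hy1)
  have hne : (C ∩ Metric.ball x r).Nonempty := by
    obtain ⟨y, hy1, hy2⟩ := mem_closure_iff_nhds.1 hx _ (Metric.ball_mem_nhds x hr)
    exact ⟨y, hy2, hy1⟩
  rcases h2 with h2 | h2
  · rcases h1 with h1 | h1
    · refine absurd (fun z hz => ?_) hnot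
      rcases mem_sector_or_mem_sector_or_mem_ray hz (α := α) (β := β) with h | h | h
      · exact subset_closure (h1 h)
      · exact subset_closure (h2 h)
      · exact closure_mono h1 (mem_closure_sectors hαβ hβ hz h).1
    · refine ⟨β, α + 2 * Real.pi, hβ, by linarith, ?_, ?_⟩
      · rwa [angleRay_add_two_pi, union_comm]
      · refine Subset.antisymm (fun z hz => ?_) fun z hz => ⟨h2 hz, sector_subset_ball _ _ _ _ hz⟩
        rcases mem_sector_or_mem_sector_or_mem_ray hz.2 (α := α) (β := β) with h | h | h
        · exact absurd (subset_closure hz.1) (disjoint_left.1 h1 h)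
        · exact h
        · exact absurd hz.1 (hray _ h1 z (mem_closure_sectors hαβ hβ hz.2 h).1)
  · have hsub : C ∩ Metric.ball x r ⊆ sector x α β r := by
      intro z hz
      rcases mem_sector_or_mem_sector_or_mem_ray hz.2 (α := α) (β := β) with h | h | h
      · exact h
      · exact absurd (subset_closure hz.1) (disjoint_left.1 h2 h)
      · exact absurd hz.1 (hray _ h2 z (mem_closure_sectors hαβ hβ hz.2 h).2)
    refine ⟨α, β, hαβ, hβ, hfr, Subset.antisymm hsub fun z hz =>
      ⟨?_, sector_subset_ball _ _ _ _ hz⟩⟩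
    obtain ⟨y, hy⟩ := hne
    rcases h1 with h1 | h1
    · exact h1 hz
    · exact absurd (subset_closure hy.1) (disjoint_left.1 h1 (hsub hy))

/-- Two segments with a common end point lie on two distinct rays. -/
theorem exists_segment_union_subset_angleRay (x c₁ c₂ : ℂ) :
    ∃ α β : ℝ, α < β ∧ β < α + 2 * Real.pi ∧
      segment ℝ x c₁ ∪ segment ℝ x c₂ ⊆ angleRay x α ∪ angleRay x β := by
  have hseg : ∀ c : ℂ, segment ℝ x c ⊆ angleRay x (c - x).arg := by
    rintro c z hz
    rw [segment_eq_image'] at hz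
    obtain ⟨t, ht, rfl⟩ := hz
    refine ⟨t * ‖c - x‖, mul_nonneg ht.1 (norm_nonneg _), ?_⟩
    push_cast
    rw [mul_assoc, Complex.norm_mul_exp_arg_mul_I]
    simp
  have h1 := hseg c₁
  have h2 := hseg c₂
  have a1 := Complex.neg_pi_lt_arg (c₁ - x)
  have a2 := Complex.arg_le_pi (c₁ - x)
  have b1 := Complex.neg_pi_lt_arg (c₂ - x)
  have b2 := Complex.arg_le_pi (c₂ - x)
  rcases lt_trichotomy (c₁ - x).arg (c₂ - x).arg with h | h | h
  · exact ⟨_, _, h, by linarith, union_subset_union h1 h2⟩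
  · refine ⟨(c₁ - x).arg, (c₁ - x).arg + 1, by linarith, by linarith [Real.pi_gt_three],
      union_subset (h1.trans subset_union_left) ?_⟩
    rw [h]
    exact h2.trans subset_union_left
  · exact ⟨_, _, h, by linarith,
      union_subset (h1.trans subset_union_right) (h2.trans subset_union_left)⟩

end PlaneTopology

section Polygons
open Filter Topology

/-! ### Simple polygons and polygonal cells -/

/-- A point of a segment splits it into two segments issuing from that point. -/
theorem segment_subset_union_of_mem {a b x : ℂ} (hx : x ∈ segment ℝ a b) :
    segment ℝ a b ⊆ segment ℝ x a ∪ segment ℝ x b := by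
  rw [← insert_endpoints_openSegment]
  refine insert_subset (Or.inl (right_mem_segment _ _ _))
    (insert_subset (Or.inr (right_mem_segment _ _ _)) ?_)
  rw [segment_eq_image_lineMap] at hx
  refine (openSegment_subset_union a b (image_subset_range _ _ hx)).trans
    (insert_subset (Or.inl (left_mem_segment _ _ _)) (union_subset_union ?_ ?_))
  · rw [openSegment_symm]
    exact openSegment_subset_segment _ _ _
  · exact openSegment_subset_segment _ _ _

namespace Polygon

theorem edgeSet_eq_segment {n : ℕ} (P : Polygon ℂ n) (i : Fin n) :
    P.edgeSet ℝ i = segment ℝ (P i) (P (finRotate n i)) :=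
  affineSegment_eq_segment ..

theorem isClosed_edgeSet {n : ℕ} (P : Polygon ℂ n) (i : Fin n) : IsClosed (P.edgeSet ℝ i) := by
  rw [edgeSet_eq_segment, ← closure_openSegment]
  exact isClosed_closure

theorem isPreconnected_boundary {n : ℕ} (P : Polygon ℂ n) : IsPreconnected (P.boundary ℝ) := by
  cases n with
  | zero => simpa [boundary] using isPreconnected_empty
  | succ n =>
    refine IsPreconnected.iUnion_of_reflTransGen (fun i => ?_) fun i j => ?_
    · rw [edgeSet_eq_segment]
      exact (convex_segment _ _).isPreconnected
    · have hstep : ∀ i : Fin (n + 1),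
          (P.edgeSet ℝ i ∩ P.edgeSet ℝ (finRotate (n + 1) i)).Nonempty := fun i => by
        refine ⟨P (finRotate _ i), ?_, ?_⟩
        · rw [edgeSet_eq_segment]; exact right_mem_segment _ _ _
        · rw [edgeSet_eq_segment]; exact left_mem_segment _ _ _
      have hzero : ∀ i : Fin (n + 1), Relation.ReflTransGen
          (fun i j => (P.edgeSet ℝ i ∩ P.edgeSet ℝ j).Nonempty) 0 i := by
        intro i
        induction i using Fin.induction with
        | zero => exact .refl
        | succ i ih =>
          refine ih.tail ?_
          have := hstep i.castSucc
          rwa [finRotate_apply, Fin.coeSucc_eq_succ] at this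
      have hsymm : Std.Symm fun i j => (P.edgeSet ℝ i ∩ P.edgeSet ℝ j).Nonempty :=
        ⟨fun i j h => by rwa [inter_comm]⟩
      exact (Relation.ReflTransGen.stdSymm.symm _ _ (hzero i)).trans (hzero j)

/-- Near each of its points a simple polygon lies on two segments issuing from that point. -/
theorem IsSimple.exists_boundary_subset {n : ℕ} {P : Polygon ℂ n} (hP : P.IsSimple) {x : ℂ}
    (hx : x ∈ P.boundary ℝ) : ∃ c₁ c₂ : ℂ, ∃ r > 0,
      P.boundary ℝ ∩ Metric.ball x r ⊆ segment ℝ x c₁ ∪ segment ℝ x c₂ := by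
  obtain ⟨r, hr, hball⟩ := exists_ball_forall_mem_imp P.isClosed_edgeSet x
  suffices h : ∃ c₁ c₂ : ℂ, ∀ j, x ∈ P.edgeSet ℝ j →
      P.edgeSet ℝ j ⊆ segment ℝ x c₁ ∪ segment ℝ x c₂ by
    obtain ⟨c₁, c₂, h⟩ := h
    refine ⟨c₁, c₂, r, hr, ?_⟩
    rintro z ⟨hz, hzr⟩
    obtain ⟨j, hj⟩ := mem_iUnion.1 hz
    exact h j (hball j z hzr hj) hj
  obtain ⟨-, hinj, hint⟩ := hP
  obtain ⟨k, hk⟩ := mem_iUnion.1 hx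
  by_cases hv : ∃ l, x = P l
  · obtain ⟨l, rfl⟩ := hv
    refine ⟨P ((finRotate n).symm l), P (finRotate n l), fun j hj => ?_⟩
    by_cases hjl : j = l
    · subst hjl
      rw [edgeSet_eq_segment]
      exact subset_union_right
    · have hl : P l ∈ P.edgeSet ℝ l := by
        rw [edgeSet_eq_segment]; exact left_mem_segment _ _ _
      have := (hint j l hjl ⟨hj, hl⟩).1
      rcases this with h | h
      · exact absurd (hinj h).symm hjl
      · have hl' : l = finRotate n j := hinj h
        subst hl'
        rw [edgeSet_eq_segment, segment_symm, Equiv.symm_apply_apply]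
        exact subset_union_left
  · refine ⟨P k, P (finRotate n k), fun j hj => ?_⟩
    by_cases hjk : j = k
    · subst hjk
      rw [edgeSet_eq_segment] at hj ⊢
      exact segment_subset_union_of_mem hj
    · rcases (hint j k hjk ⟨hj, hk⟩).2 with h | h
      · exact absurd ⟨_, h⟩ hv
      · exact absurd ⟨_, h⟩ hv

end Polygon

namespace IsPolygonalCell

variable {C : Set ℂ}

/-- Near each of its points the boundary of a polygonal cell lies on two rays. The rays are not
claimed to be covered by the boundary. -/
theorem exists_frontier_subset_angleRay (hC : IsPolygonalCell C) {x : ℂ} (hx : x ∈ frontier C) :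
    ∃ α β : ℝ, ∃ r > 0, α < β ∧ β < α + 2 * Real.pi ∧
      frontier C ∩ Metric.ball x r ⊆ angleRay x α ∪ angleRay x β := by
  obtain ⟨n, P, hP, hfr⟩ := hC.frontier_eq
  rw [hfr] at hx ⊢
  obtain ⟨c₁, c₂, r, hr, h⟩ := hP.exists_boundary_subset hx
  obtain ⟨α, β, h1, h2, h3⟩ := exists_segment_union_subset_angleRay x c₁ c₂
  exact ⟨α, β, r, hr, h1, h2, h.trans h3⟩

theorem isPreconnected_frontier (hC : IsPolygonalCell C) : IsPreconnected (frontier C) := by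
  obtain ⟨n, P, -, hfr⟩ := hC.frontier_eq
  rw [hfr]
  exact P.isPreconnected_boundary

theorem closure_ne_univ (hC : IsPolygonalCell C) : closure C ≠ univ := fun h => by
  have := hC.isBounded.closure
  rw [h] at this
  exact NormedSpace.unbounded_univ ℝ ℂ this

/-- A polygonal cell lies on one side only of its boundary: otherwise, following the
boundary polygon, the closure of the cell would be a neighbourhood of all its points. -/
theorem closure_notMem_nhds (hC : IsPolygonalCell C) {q : ℂ} (hq : q ∈ frontier C) :
    closure C ∉ 𝓝 q := by
  intro hqC
  have hloc : ∀ x ∈ frontier C, ∃ r > 0,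
      ((frontier C ∩ interior (closure C)) ∩ Metric.ball x r).Nonempty →
        Metric.ball x r ⊆ closure C := by
    intro x hx
    obtain ⟨α, β, r, hr, h1, h2, h3⟩ := hC.exists_frontier_subset_angleRay hx
    refine ⟨r, hr, fun ⟨y, ⟨hy1, hy2⟩, hy3⟩ => ?_⟩
    exact ball_subset_closure_of_mem_nhds hC.isOpen h1 h2 h3 hy3 (h3 ⟨hy1, hy3⟩)
      (mem_interior_iff_mem_nhds.1 hy2)
  have hall : frontier C ⊆ interior (closure C) := by
    have hcl : closure (frontier C ∩ interior (closure C)) ∩ frontier C ⊆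
        interior (closure C) := by
      rintro x ⟨hx, hxf⟩
      obtain ⟨r, hr, h⟩ := hloc x hxf
      obtain ⟨y, hy1, hy2⟩ := mem_closure_iff_nhds.1 hx _ (Metric.ball_mem_nhds x hr)
      exact mem_interior_iff_mem_nhds.2
        (mem_of_superset (Metric.ball_mem_nhds x hr) (h ⟨y, hy2, hy1⟩))
    have hcov : frontier C ⊆
        interior (closure C) ∪ (closure (frontier C ∩ interior (closure C)))ᶜ := by
      intro x hx
      by_cases h : x ∈ closure (frontier C ∩ interior (closure C))
      · exact Or.inl (hcl ⟨h, hx⟩)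
      · exact Or.inr h
    by_contra hnot
    obtain ⟨x, hx, hxn⟩ := not_subset.1 hnot
    obtain ⟨y, hy, hy1, hy2⟩ := hC.isPreconnected_frontier _ _ isOpen_interior
      isClosed_closure.isOpen_compl hcov ⟨q, hq, mem_interior_iff_mem_nhds.2 hqC⟩
      ⟨x, hx, (hcov hx).resolve_left hxn⟩
    exact hy2 (subset_closure ⟨hy, hy1⟩)
  have hopen : IsOpen (closure C) := by
    have : closure C ⊆ interior (closure C) := by
      rw [closure_eq_self_union_frontier]
      refine union_subset ?_ ?_
      · rw [← closure_eq_self_union_frontier]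
        exact interior_maximal subset_closure hC.isOpen
      · rwa [← closure_eq_self_union_frontier]
    rw [this.antisymm interior_subset]
    exact isOpen_interior
  rcases isClopen_iff.1 ⟨isClosed_closure, hopen⟩ with h | h
  · exact hC.isConnected.nonempty.ne_empty (closure_empty_iff _ |>.1 h)
  · exact hC.closure_ne_univ h

/-- Near each of its boundary points a polygonal cell is a sector. -/
theorem exists_inter_ball_eq_sector (hC : IsPolygonalCell C) {x : ℂ} (hx : x ∈ frontier C) :
    ∃ α β : ℝ, ∃ r > 0, α < β ∧ β < α + 2 * Real.pi ∧
      frontier C ∩ Metric.ball x r ⊆ angleRay x α ∪ angleRay x β ∧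
      C ∩ Metric.ball x r = sector x α β r := by
  obtain ⟨α, β, r, hr, h1, h2, h3⟩ := hC.exists_frontier_subset_angleRay hx
  obtain ⟨α', β', h⟩ := _root_.exists_inter_ball_eq_sector hC.isOpen hr
    (frontier_subset_closure hx) h1 h2 h3
    fun h => hC.closure_notMem_nhds hx (mem_of_superset (Metric.ball_mem_nhds x hr) h)
  exact ⟨α', β', r, hr, h⟩

end IsPolygonalCell

end Polygons

section ThinTriangles
open Filter Topology

/-! ### Thin triangles along a segment -/

/-- The open triangle with base `[a, b]` and apex over the middle of the base. Its shape is
governed by `ε`: for `ε > 0` it lies to the left of the base, for `ε < 0` to the right. -/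
def thinTriangle (a b : ℂ) (ε : ℝ) : Set ℂ :=
  (fun q : ℝ × ℝ => a + (b - a) * (q.1 + ε * q.2 * Complex.I)) ''
    {q | 0 < q.2 ∧ q.2 < q.1 ∧ q.2 < 1 - q.1}

theorem convex_thinTriangle (a b : ℂ) (ε : ℝ) : Convex ℝ (thinTriangle a b ε) := by
  rintro _ ⟨⟨t, s⟩, ⟨h1, h2, h3⟩, rfl⟩ _ ⟨⟨t', s'⟩, ⟨h1', h2', h3'⟩, rfl⟩ p q hp hq hpq
  dsimp only at h1 h2 h3 h1' h2' h3'
  obtain rfl : q = 1 - p := by linarith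
  refine ⟨(p * t + (1 - p) * t', p * s + (1 - p) * s'), ⟨?_, ?_, ?_⟩, ?_⟩
  · rcases hp.eq_or_lt with rfl | hp
    · simpa using h1'
    · exact add_pos_of_pos_of_nonneg (mul_pos hp h1) (mul_nonneg hq h1'.le)
  · rcases hp.eq_or_lt with rfl | hp
    · simpa using h2'
    · exact add_lt_add_of_lt_of_le (mul_lt_mul_of_pos_left h2 hp)
        (mul_le_mul_of_nonneg_left h2'.le hq)
  · rcases hp.eq_or_lt with rfl | hp
    · simpa using h3'
    · have := mul_lt_mul_of_pos_left h3 hp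
      have := mul_le_mul_of_nonneg_left h3'.le hq
      dsimp only
      linarith
  · simp only [Complex.real_smul]
    push_cast
    ring

theorem isPreconnected_thinTriangle (a b : ℂ) (ε : ℝ) : IsPreconnected (thinTriangle a b ε) :=
  (convex_thinTriangle a b ε).isPreconnected

theorem thinTriangle_swap_subset (a b : ℂ) (ε : ℝ) :
    thinTriangle a b ε ⊆ thinTriangle b a (-ε) := by
  rintro _ ⟨⟨t, s⟩, ⟨h1, h2, h3⟩, rfl⟩
  refine ⟨(1 - t, s), ⟨h1, h3, by simpa using h2⟩, ?_⟩
  push_cast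
  ring

/-- Reversing the base exchanges left and right. -/
theorem thinTriangle_swap (a b : ℂ) (ε : ℝ) : thinTriangle b a (-ε) = thinTriangle a b ε :=
  Subset.antisymm (by simpa using thinTriangle_swap_subset b a (-ε))
    (thinTriangle_swap_subset a b ε)

theorem left_mem_closure_thinTriangle (a b : ℂ) (ε : ℝ) : a ∈ closure (thinTriangle a b ε) := by
  have hc : Continuous (fun q : ℝ × ℝ => a + (b - a) * (q.1 + ε * q.2 * Complex.I)) := by fun_prop
  refine image_closure_subset_closure_image hc ⟨(0, 0), ?_, by simp⟩
  have : Tendsto (fun t : ℝ => (t, t / 2)) (𝓝[>] 0) (𝓝 (0, 0)) := by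
    have : Continuous (fun t : ℝ => (t, t / 2)) := by fun_prop
    exact (this.tendsto' 0 _ (by simp)).mono_left nhdsWithin_le_nhds
  refine mem_closure_of_tendsto this ?_
  filter_upwards [Ioo_mem_nhdsGT (show (0 : ℝ) < 1 / 2 by norm_num)] with t ht
  exact ⟨by simpa using ht.1, by linarith [ht.1], by linarith [ht.2]⟩

theorem right_mem_closure_thinTriangle (a b : ℂ) (ε : ℝ) : b ∈ closure (thinTriangle a b ε) := by
  rw [← thinTriangle_swap]
  exact left_mem_closure_thinTriangle b a _

theorem disjoint_thinTriangle_segment {a b : ℂ} (hab : a ≠ b) {ε : ℝ} (hε : ε ≠ 0) :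
    Disjoint (thinTriangle a b ε) (segment ℝ a b) := by
  refine disjoint_left.2 ?_
  rintro _ ⟨⟨t, s⟩, ⟨h1, h2, h3⟩, rfl⟩ hz
  rw [segment_eq_image'] at hz
  obtain ⟨r, hr, h⟩ := hz
  have h' : (b - a) * (r - (t + ε * s * Complex.I)) = 0 := by
    simp only [Complex.real_smul] at h
    linear_combination h
  rcases mul_eq_zero.1 h' with h' | h'
  · exact hab (sub_eq_zero.1 h').symm
  · have := congrArg Complex.im h'
    simp at this
    rcases this with h | h
    · exact hε h
    · exact h1.ne' h

/-- Moving off an interior point of a segment at a right angle one enters a thin triangle. -/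
theorem eventually_mem_thinTriangle (a b : ℂ) {t κ ε : ℝ} (ht0 : 0 < t) (ht1 : t < 1)
    (h : 0 < κ * ε) :
    ∀ᶠ s : ℝ in 𝓝[>] 0, a + (b - a) * t + s * (κ * Complex.I * (b - a)) ∈ thinTriangle a b ε := by
  have hε : ε ≠ 0 := by rintro rfl; simp at h
  have hpos : 0 < κ / ε := by
    rw [← mul_div_mul_right κ ε hε]
    exact div_pos h (mul_self_pos.2 hε)
  have hlim : Tendsto (fun s : ℝ => s * (κ / ε)) (𝓝[>] 0) (𝓝 0) := by
    have : Continuous (fun s : ℝ => s * (κ / ε)) := by fun_prop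
    exact (this.tendsto' 0 _ (by simp)).mono_left nhdsWithin_le_nhds
  filter_upwards [self_mem_nhdsWithin, hlim.eventually_lt_const ht0,
    hlim.eventually_lt_const (sub_pos.2 ht1)] with s hs h1 h2
  refine ⟨(t, s * (κ / ε)), ⟨mul_pos hs hpos, h1, h2⟩, ?_⟩
  have : (ε : ℂ) ≠ 0 := Complex.ofReal_ne_zero.2 hε
  push_cast
  field_simp
  ring

/-- The two thin triangles over a segment and the segment itself fill a neighbourhood of each
interior point of the segment. -/
theorem eventually_mem_thinTriangle_or_mem_segment {a b : ℂ} (hab : a ≠ b) {t ε : ℝ}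
    (ht0 : 0 < t) (ht1 : t < 1) (hε : 0 < ε) :
    ∀ᶠ z in 𝓝 (a + (b - a) * t),
      z ∈ thinTriangle a b ε ∪ thinTriangle a b (-ε) ∪ segment ℝ a b := by
  have hba : b - a ≠ 0 := sub_ne_zero.2 hab.symm
  have hlim : Tendsto (fun z => (z - a) / (b - a)) (𝓝 (a + (b - a) * t)) (𝓝 t) := by
    have : Continuous (fun z => (z - a) / (b - a)) := by fun_prop
    refine this.tendsto' _ _ ?_
    field_simp
    ring
  have hre : Tendsto (fun z => ((z - a) / (b - a)).re) (𝓝 (a + (b - a) * t)) (𝓝 t) :=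
    (Complex.continuous_re.tendsto' _ _ (Complex.ofReal_re t)).comp hlim
  have him : Tendsto (fun z => |((z - a) / (b - a)).im| / ε) (𝓝 (a + (b - a) * t)) (𝓝 0) := by
    have : Continuous (fun ζ : ℂ => |ζ.im| / ε) := by fun_prop
    exact (this.tendsto' _ _ (by simp)).comp hlim
  filter_upwards [him.eventually_lt hre ht0,
    him.eventually_lt (hre.const_sub 1) (by linarith)] with z h1 h2
  set ζ := (z - a) / (b - a) with hζ
  have hz : z = a + (b - a) * ζ := by rw [hζ]; field_simp; ring
  have hεc : (ε : ℂ) ≠ 0 := Complex.ofReal_ne_zero.2 hε.ne'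
  have hζ' : (ζ.re + ζ.im * Complex.I : ℂ) = ζ := Complex.re_add_im ζ
  rcases lt_trichotomy ζ.im 0 with h | h | h
  · left; right
    rw [abs_of_neg h] at h1 h2
    refine ⟨(ζ.re, -ζ.im / ε), ⟨div_pos (neg_pos.2 h) hε, h1, h2⟩, ?_⟩
    rw [hz]
    conv_rhs => rw [← hζ']
    push_cast
    field_simp
  · right
    rw [h, abs_zero, zero_div] at h1 h2
    rw [segment_eq_image']
    refine ⟨ζ.re, ⟨h1.le, by linarith⟩, ?_⟩
    rw [hz, ← hζ', h]
    simp [mul_comm]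
  · left; left
    rw [abs_of_pos h] at h1 h2
    refine ⟨(ζ.re, ζ.im / ε), ⟨div_pos h hε, h1, h2⟩, ?_⟩
    rw [hz]
    conv_rhs => rw [← hζ']
    push_cast
    field_simp

/-- Next to a bounding ray a sector meets the thin triangle on the sector's side of that ray. -/
theorem sector_inter_thinTriangle_nonempty {x b : ℂ} {α β r θ σ ε : ℝ} (hxb : x ≠ b) (hr : 0 < r)
    (hb : b - x = ‖b - x‖ * Complex.exp (θ * Complex.I)) (hε : 0 < σ * ε)
    (hθ : ∀ᶠ δ : ℝ in 𝓝[>] 0, θ + σ * δ ∈ Ioo α β) (hσ : |σ| = 1) :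
    (sector x α β r ∩ thinTriangle x b ε).Nonempty := by
  have hσ2 : σ * σ = 1 := by rw [← abs_mul_abs_self, hσ, one_mul]
  have hσ0 : σ ≠ 0 := by rintro rfl; simp at hσ
  have hε0 : ε ≠ 0 := by rintro rfl; simp at hε
  have hbx : 0 < ‖b - x‖ := norm_pos_iff.2 (sub_ne_zero.2 hxb.symm)
  have htan : Tendsto Real.tan (𝓝[>] 0) (𝓝 0) := by
    have : ContinuousAt Real.tan 0 := Real.continuousAt_tan.2 (by simp)
    simpa using this.tendsto.mono_left nhdsWithin_le_nhds
  obtain ⟨δ, h1, h2, h3⟩ := (hθ.and ((htan.eventually_lt_const hε).and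
    (Ioo_mem_nhdsGT (div_pos Real.pi_pos two_pos)))).exists
  have hcos : 0 < Real.cos δ := Real.cos_pos_of_mem_Ioo ⟨by linarith [h3.1, Real.pi_pos], h3.2⟩
  have htanpos : 0 < Real.tan δ := Real.tan_pos_of_pos_of_lt_pi_div_two h3.1 h3.2
  -- a point at angle `δ` from the ray, close to the apex
  have hlim : Tendsto (fun t : ℝ => ‖b - x‖ * t / Real.cos δ) (𝓝[>] 0) (𝓝 0) := by
    have : Continuous (fun t : ℝ => ‖b - x‖ * t / Real.cos δ) := by fun_prop
    exact (this.tendsto' 0 _ (by simp)).mono_left nhdsWithin_le_nhds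
  obtain ⟨t, h4, h5⟩ := ((hlim.eventually_lt_const hr).and
    (Ioo_mem_nhdsGT (show (0 : ℝ) < 1 / 2 by norm_num))).exists
  refine ⟨_, ⟨(‖b - x‖ * t / Real.cos δ, θ + σ * δ), ⟨⟨?_, h4⟩, h1⟩, rfl⟩,
    ⟨(t, t * (Real.tan δ / (σ * ε))), ⟨?_, ?_, ?_⟩, ?_⟩⟩
  · exact div_pos (mul_pos hbx h5.1) hcos
  · exact mul_pos h5.1 (div_pos htanpos hε)
  · have : Real.tan δ / (σ * ε) < 1 := (div_lt_one hε).2 h2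
    dsimp only
    nlinarith [h5.1]
  · have : Real.tan δ / (σ * ε) < 1 := (div_lt_one hε).2 h2
    dsimp only
    nlinarith [h5.1, h5.2]
  · have hcos' : (Real.cos δ : ℂ) ≠ 0 := Complex.ofReal_ne_zero.2 hcos.ne'
    have hσc : (σ : ℂ) ≠ 0 := Complex.ofReal_ne_zero.2 hσ0
    have hεc : (ε : ℂ) ≠ 0 := Complex.ofReal_ne_zero.2 hε0
    have hexp : Complex.exp ((σ * δ : ℝ) * Complex.I) =
        Real.cos δ + σ * Real.sin δ * Complex.I := by
      rcases (abs_eq zero_le_one).1 hσ with rfl | rfl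
      · simp [Complex.exp_mul_I]
      · rw [Complex.exp_mul_I]
        simp
    have h1 : Complex.exp (((θ + σ * δ : ℝ) : ℂ) * Complex.I) =
        Complex.exp (θ * Complex.I) * (Real.cos δ + σ * Real.sin δ * Complex.I) := by
      rw [← hexp, ← Complex.exp_add]; push_cast; ring_nf
    have hσc2 : (σ : ℂ) * σ = 1 := by exact_mod_cast hσ2
    dsimp only
    rw [h1, Real.tan_eq_sin_div_cos]
    conv_lhs => rw [hb]
    generalize Real.cos δ = c at hcos'
    generalize Real.sin δ = d
    push_cast
    field_simp
    linear_combination (-(‖b - x‖ : ℂ) * Complex.exp (θ * Complex.I) * t * Complex.I * d) * hσc2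

end ThinTriangles

section SegmentsNearSegment
open Filter Topology

/-! ### Thin triangles avoiding finitely many segments -/

/-- If a convex set contains `0` but no small positive real, then a segment from `0` to one of its
points either avoids the right half plane or has nonzero slope there. -/
theorem exists_mul_re_le_abs_im_of_zero_mem {S : Set ℂ} (hS : Convex ℝ S) (h0 : (0 : ℂ) ∈ S)
    (hreal : ∀ t : ℝ, 0 < t → t ≤ 1 / 2 → (t : ℂ) ∉ S) {c : ℂ} (hc : c ∈ S) :
    ∃ ε > 0, ∀ ζ ∈ segment ℝ 0 c, 0 < ζ.re → ε * ζ.re ≤ |ζ.im| := by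
  have hmem : ∀ ζ ∈ segment ℝ 0 c, ∃ s : ℝ, 0 ≤ s ∧ ζ = s * c := by
    intro ζ hζ
    rw [segment_eq_image'] at hζ
    obtain ⟨s, hs, rfl⟩ := hζ
    exact ⟨s, hs.1, by simp⟩
  by_cases hre : c.re ≤ 0
  · refine ⟨1, one_pos, fun ζ hζ hpos => ?_⟩
    obtain ⟨s, hs, rfl⟩ := hmem ζ hζ
    simp only [Complex.re_ofReal_mul] at hpos
    nlinarith
  push Not at hre
  have him : c.im ≠ 0 := by
    intro him
    have hc' : c = (c.re : ℂ) := by apply Complex.ext <;> simp [him]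
    refine hreal (min (1 / 2) c.re) (lt_min (by norm_num) hre) (min_le_left _ _) ?_
    refine hS.segment_subset h0 hc ?_
    rw [segment_eq_image']
    refine ⟨min (1 / 2) c.re / c.re, ⟨by positivity, (div_le_one hre).2 (min_le_right _ _)⟩, ?_⟩
    dsimp only
    rw [hc', Complex.ofReal_re, sub_zero, zero_add, Complex.real_smul, ← Complex.ofReal_mul,
      div_mul_cancel₀ _ hre.ne']
  refine ⟨|c.im| / c.re, div_pos (abs_pos.2 him) hre, fun ζ hζ _ => ?_⟩
  obtain ⟨s, hs, rfl⟩ := hmem ζ hζ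
  simp only [Complex.re_ofReal_mul, Complex.im_ofReal_mul, abs_mul, abs_of_nonneg hs]
  apply le_of_eq
  field_simp

/-- A segment that meets the real interval `[0, 1/2]` at most in `0` leaves free a cone around
that interval. -/
theorem exists_mul_re_le_abs_im {c d : ℂ}
    (hreal : ∀ t : ℝ, 0 < t → t ≤ 1 / 2 → (t : ℂ) ∉ segment ℝ c d) :
    ∃ ε > 0, ∀ ζ ∈ segment ℝ c d, 0 < ζ.re → ζ.re ≤ 1 / 2 → ε * ζ.re ≤ |ζ.im| := by
  have hconv := convex_segment (𝕜 := ℝ) c d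
  by_cases h0 : (0 : ℂ) ∈ segment ℝ c d
  · obtain ⟨ε₁, hε₁, h1⟩ :=
      exists_mul_re_le_abs_im_of_zero_mem hconv h0 hreal (left_mem_segment ℝ c d)
    obtain ⟨ε₂, hε₂, h2⟩ :=
      exists_mul_re_le_abs_im_of_zero_mem hconv h0 hreal (right_mem_segment ℝ c d)
    refine ⟨min ε₁ ε₂, lt_min hε₁ hε₂, fun ζ hζ hpos _ => ?_⟩
    rcases segment_subset_union_of_mem h0 hζ with h | h
    · exact (mul_le_mul_of_nonneg_right (min_le_left _ _) hpos.le).trans (h1 ζ h hpos)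
    · exact (mul_le_mul_of_nonneg_right (min_le_right _ _) hpos.le).trans (h2 ζ h hpos)
  · have hcomp : IsCompact (segment ℝ c d ∩ {ζ : ℂ | 0 ≤ ζ.re ∧ ζ.re ≤ 1 / 2}) := by
      refine IsCompact.inter_right ?_ ?_
      · rw [← convexHull_pair]
        exact (Set.toFinite {c, d}).isCompact_convexHull ℝ
      · exact (isClosed_le continuous_const Complex.continuous_re).inter
          (isClosed_le Complex.continuous_re continuous_const)
    rcases eq_empty_or_nonempty (segment ℝ c d ∩ {ζ : ℂ | 0 ≤ ζ.re ∧ ζ.re ≤ 1 / 2}) with he | hne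
    · refine ⟨1, one_pos, fun ζ hζ h1 h2 => ?_⟩
      have : ζ ∈ segment ℝ c d ∩ {ζ : ℂ | 0 ≤ ζ.re ∧ ζ.re ≤ 1 / 2} := ⟨hζ, h1.le, h2⟩
      rw [he] at this
      exact absurd this (notMem_empty _)
    · obtain ⟨ζ₀, ⟨hζ₀, h1, h2⟩, hmin⟩ := hcomp.exists_isMinOn hne
        (continuous_abs.comp Complex.continuous_im).continuousOn
      have hδ : 0 < |ζ₀.im| := by
        refine abs_pos.2 fun him => ?_
        have hζ' : ζ₀ = (ζ₀.re : ℂ) := by apply Complex.ext <;> simp [him]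
        rcases h1.eq_or_lt with h | h
        · rw [← h, Complex.ofReal_zero] at hζ'
          exact h0 (hζ' ▸ hζ₀)
        · exact hreal _ h h2 (hζ' ▸ hζ₀)
      refine ⟨|ζ₀.im|, hδ, fun ζ hζ h3 h4 => ?_⟩
      have : |ζ₀.im| ≤ |ζ.im| := hmin ⟨hζ, h3.le, h4⟩
      nlinarith

/-- A segment that meets `[a, b]` at most in `a` and `b` avoids a thin cone with apex `a` around the
first half of `[a, b]`. -/
theorem exists_cone_disjoint_segment {a b c d : ℂ} (hab : a ≠ b)
    (h : segment ℝ c d ∩ segment ℝ a b ⊆ {a, b}) :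
    ∃ ε > 0, ∀ t s : ℝ, 0 < t → t ≤ 1 / 2 → |s| < ε * t →
      a + (b - a) * (t + s * Complex.I) ∉ segment ℝ c d := by
  have hba : b - a ≠ 0 := sub_ne_zero.2 hab.symm
  -- in the coordinate where `a = 0` and `b = 1`
  have hmap : ∀ ζ : ℂ, a + (b - a) * ζ ∈ segment ℝ c d ↔
      ζ ∈ segment ℝ ((c - a) / (b - a)) ((d - a) / (b - a)) := by
    intro ζ
    simp only [segment_eq_image', mem_image]
    refine exists_congr fun r => and_congr_right fun _ => ?_
    simp only [Complex.real_smul]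
    constructor
    · intro h
      field_simp
      linear_combination h
    · intro h
      field_simp at h
      linear_combination h
  obtain ⟨ε, hε, hcone⟩ := exists_mul_re_le_abs_im (c := (c - a) / (b - a))
    (d := (d - a) / (b - a)) (by
      intro t ht ht' hmem
      rw [← hmap] at hmem
      have hseg : a + (b - a) * t ∈ segment ℝ a b := by
        rw [segment_eq_image']
        exact ⟨t, ⟨ht.le, by linarith⟩, by simp [mul_comm]⟩
      rcases h ⟨hmem, hseg⟩ with h | h
      · have : (b - a) * t = 0 := by linear_combination h
        rcases mul_eq_zero.1 this with h | h
        · exact hba h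
        · exact ht.ne' (by exact_mod_cast h)
      · rw [mem_singleton_iff] at h
        have : (b - a) * (t - 1) = 0 := by linear_combination h
        rcases mul_eq_zero.1 this with h | h
        · exact hba h
        · have : t = 1 := by exact_mod_cast sub_eq_zero.1 h
          linarith)
  refine ⟨ε, hε, fun t s ht ht' hs hmem => ?_⟩
  rw [hmap] at hmem
  have := hcone _ hmem (by simpa using ht) (by simpa using ht')
  simp at this
  linarith

/-- A thin triangle is covered by two thin cones with apexes at the ends of its base, so that it
avoids a segment meeting the base at most in the end points of the base. -/
theorem exists_thinTriangle_disjoint_segment {a b c d : ℂ} (hab : a ≠ b)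
    (h : segment ℝ c d ∩ segment ℝ a b ⊆ {a, b}) :
    ∃ ε₀ > 0, ∀ ε : ℝ, |ε| ≤ ε₀ → Disjoint (thinTriangle a b ε) (segment ℝ c d) := by
  obtain ⟨ε₁, hε₁, h1⟩ := exists_cone_disjoint_segment hab h
  obtain ⟨ε₂, hε₂, h2⟩ := exists_cone_disjoint_segment hab.symm (c := c) (d := d)
    (by rwa [segment_symm ℝ b a, pair_comm])
  refine ⟨min ε₁ ε₂, lt_min hε₁ hε₂, fun ε hε => disjoint_left.2 ?_⟩
  rintro _ ⟨⟨t, s⟩, ⟨hs, hst, hst'⟩, rfl⟩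
  have habs : ∀ ε' u : ℝ, min ε₁ ε₂ ≤ ε' → 0 < ε' → s < u → |ε| * s < ε' * u := by
    intro ε' u h1 h2 h3
    calc |ε| * s ≤ ε' * s := mul_le_mul_of_nonneg_right (hε.trans h1) hs.le
      _ < ε' * u := mul_lt_mul_of_pos_left h3 h2
  dsimp only at hs hst hst'
  rcases le_total t (1 / 2) with ht | ht
  · have := h1 t (ε * s) (hs.trans hst) ht (by
      rw [abs_mul, abs_of_pos hs]
      exact habs _ _ (min_le_left _ _) hε₁ hst)
    simpa using this
  · have := h2 (1 - t) (-(ε * s)) (hs.trans hst') (by linarith) (by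
      rw [abs_neg, abs_mul, abs_of_pos hs]
      exact habs _ _ (min_le_right _ _) hε₂ hst')
    convert this using 2
    push_cast
    ring

end SegmentsNearSegment

section ComplexPlane

theorem Complex.eq_mul_I_mul_of_inner_eq_zero {v w : ℂ} (hv : v ≠ 0) (h : inner ℝ v w = 0) :
    ∃ κ : ℝ, w = κ * Complex.I * v := by
  refine ⟨((starRingEnd ℂ) v * w).im / Complex.normSq v, ?_⟩
  have h1 : ((starRingEnd ℂ) v * w).re = 0 := by rw [← h, Complex.inner, mul_comm]
  have h2 : (starRingEnd ℂ) v * w = ((starRingEnd ℂ) v * w).im * Complex.I := by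
    apply Complex.ext
    · simpa using h1
    · simp
  have h3 : (Complex.normSq v : ℂ) ≠ 0 := by simpa using hv
  have h4 : (starRingEnd ℂ) v * v = Complex.normSq v := by
    rw [Complex.normSq_eq_conj_mul_self]
  rw [Complex.ofReal_div]
  have h5 : (Complex.normSq v : ℂ) * w = v * ((starRingEnd ℂ) v * w) := by rw [← h4]; ring
  rw [h2] at h5
  generalize ((starRingEnd ℂ) v * w).im = m at h5 ⊢
  field_simp
  linear_combination h5

end ComplexPlane

namespace StaggeredMesh
open Filter Topology

variable {Ω : Set ℂ} {I N E : Type*} [Fintype I] [Fintype N] [Fintype E]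
  (M : StaggeredMesh Ω I N E)

/-! ### Incidences of the staggered meshes -/

theorem mem_EC {e : E} {i : I} : e ∈ M.EC i ↔ i ∈ M.CE e := by
  simp [MeshData.EC]

/-- A primary cell has edges, as otherwise its frontier would be empty. -/
theorem exists_mem_CE (i : I) : ∃ e, i ∈ M.CE e := by
  by_contra! h
  have hfr : frontier (M.cell i) = ∅ := by
    rw [M.frontier_cell]
    have : ∀ e, e ∉ M.EC i := fun e he => h e (M.mem_EC.1 he)
    simp [this]
  have hC := M.isPolygonalCell_cell i
  have hclopen : IsClopen (M.cell i) := isClopen_iff_frontier_eq_empty.2 hfr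
  rcases isClopen_iff.1 hclopen with h | h
  · exact hC.isConnected.nonempty.ne_empty h
  · exact hC.closure_ne_univ (by rw [h, closure_univ])

theorem exists_mem_VE (e : E) : ∃ ν, ν ∈ M.VE e := by
  by_cases he : e ∈ M.bdryEdge
  · obtain ⟨ν, hν⟩ := M.VE_bdry e he
    exact ⟨ν, Finset.mem_coe.1 (hν ▸ mem_singleton ν)⟩
  · obtain ⟨μ, ν, -, hν, -⟩ := M.VE_interior e he
    exact ⟨ν, Finset.mem_coe.1 (hν ▸ mem_insert_of_mem _ (mem_singleton ν))⟩

theorem center_mem_dualEdge {e : E} {i : I} (h : i ∈ M.CE e) : M.center i ∈ M.dualEdge e :=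
  subset_convexHull ℝ _ (mem_image_of_mem _ h)

/-- A center on a dual edge is an end point of it. -/
theorem mem_CE_of_center_mem_dualEdge {e : E} {i : I} (h : M.center i ∈ M.dualEdge e) :
    i ∈ M.CE e := by
  obtain ⟨e', he'⟩ := M.exists_mem_CE i
  by_cases hee : e = e'
  · rwa [hee]
  · obtain ⟨k, ⟨hk, -⟩, hki⟩ := M.dualEdge_inter e e' hee ⟨h, M.center_mem_dualEdge he'⟩
    rwa [← M.center_injective hki]

variable {M}

theorem dualEdge_eq_segment {e : E} {i j : I} (h : (M.CE e : Set I) = {i, j}) :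
    M.dualEdge e = segment ℝ (M.center i) (M.center j) := by
  rw [MeshData.dualEdge, h, image_pair, convexHull_pair]

variable (M)

theorem isCompact_dualEdge (e : E) : IsCompact (M.dualEdge e) :=
  ((M.CE e).finite_toSet.image _).isCompact_convexHull ℝ

theorem exists_CE_eq {e : E} {i : I} (h : i ∈ M.CE e) :
    ∃ j, i ≠ j ∧ (M.CE e : Set I) = {i, j} := by
  obtain ⟨k, l, hkl, hCE, -⟩ := M.CE_spec e
  have : i ∈ ({k, l} : Set I) := hCE ▸ h
  rcases this with rfl | rfl
  · exact ⟨l, hkl, hCE⟩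
  · exact ⟨k, hkl.symm, by rw [hCE, pair_comm]⟩

variable {M}

theorem mid_mem_openSegment {e : E} {i j : I} (hij : i ≠ j) (h : (M.CE e : Set I) = {i, j}) :
    M.mid e ∈ openSegment ℝ (M.center i) (M.center j) := by
  obtain ⟨k, l, hkl, hCE, hmid⟩ := M.CE_spec e
  rw [hCE] at h
  rcases (pair_eq_pair_iff.1 h) with ⟨rfl, rfl⟩ | ⟨rfl, rfl⟩
  · exact hmid
  · rwa [openSegment_symm]

theorem exists_mid_eq {e : E} {i j : I} (hij : i ≠ j) (h : (M.CE e : Set I) = {i, j}) :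
    ∃ t : ℝ, 0 < t ∧ t < 1 ∧ M.mid e = M.center i + (M.center j - M.center i) * t := by
  have := mid_mem_openSegment hij h
  rw [openSegment_eq_image'] at this
  obtain ⟨t, ht, hmid⟩ := this
  exact ⟨t, ht.1, ht.2, by simp [← hmid, mul_comm]⟩

variable (M)

theorem mid_mem_dualEdge (e : E) : M.mid e ∈ M.dualEdge e := by
  obtain ⟨i, j, hij, hCE, hmid⟩ := M.CE_spec e
  rw [dualEdge_eq_segment hCE]
  exact openSegment_subset_segment _ _ _ hmid

theorem mid_mem_primaryEdge (e : E) : M.mid e ∈ M.primaryEdge e :=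
  subset_convexHull ℝ _ (mem_insert _ _)

theorem dualCenter_mem_primaryEdge {e : E} {ν : N} (h : ν ∈ M.VE e) :
    M.dualCenter ν ∈ M.primaryEdge e :=
  subset_convexHull ℝ _ (mem_insert_of_mem _ (mem_image_of_mem _ h))

theorem mid_mem_dualEdge_iff {e e' : E} : M.mid e ∈ M.dualEdge e' ↔ e = e' := by
  refine ⟨fun h => ?_, fun h => h ▸ M.mid_mem_dualEdge e⟩
  by_contra hne
  exact disjoint_left.1 (M.edge_disjoint e e' hne) (M.mid_mem_primaryEdge e) h

theorem dualEdge_subset_frontier {e : E} {ν : N} (h : ν ∈ M.VE e) :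
    M.dualEdge e ⊆ frontier (M.dualCell ν) := by
  rw [M.frontier_dualCell]
  exact subset_biUnion_of_mem (u := fun e => M.dualEdge e) h

/-- A dual edge is on the boundary of some dual cell, hence enters no dual cell. -/
theorem disjoint_dualEdge_dualCell (e : E) (ν : N) : Disjoint (M.dualEdge e) (M.dualCell ν) := by
  refine disjoint_left.2 fun z hz hzν => ?_
  obtain ⟨μ, hμ⟩ := M.exists_mem_VE e
  have hfr := M.dualEdge_subset_frontier hμ hz
  have hopen := (M.isPolygonalCell_dualCell ν).isOpen
  by_cases hμν : μ = ν
  · subst hμν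
    rw [hopen.frontier_eq] at hfr
    exact hfr.2 hzν
  · obtain ⟨y, hy1, hy2⟩ :=
      mem_closure_iff_nhds.1 (frontier_subset_closure hfr) _ (hopen.mem_nhds hzν)
    exact disjoint_left.1 (M.dualCell_disjoint μ ν hμν) hy2 hy1

theorem frontier_dualCell_subset (ν : N) : frontier (M.dualCell ν) ⊆ ⋃ e, M.dualEdge e := by
  rw [M.frontier_dualCell]
  exact iUnion_mono fun e => iUnion_subset fun _ => Subset.rfl

theorem frontier_domain_subset : frontier Ω ⊆ ⋃ e, M.dualEdge e := by
  rw [M.frontier_domain]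
  exact iUnion_mono fun e => iUnion_subset fun _ => Subset.rfl

theorem dualCenter_ne_mid {e : E} {ν : N} : M.dualCenter ν ≠ M.mid e := fun h =>
  disjoint_left.1 (M.disjoint_dualEdge_dualCell e ν) (M.mid_mem_dualEdge e)
    (h ▸ M.dualCenter_mem ν)

variable {M}

theorem center_sub_center_ne_zero {i j : I} (hij : i ≠ j) : M.center j - M.center i ≠ 0 :=
  sub_ne_zero.2 fun h => hij (M.center_injective h).symm

/-- The primary edge leaves the dual edge at a right angle: `κ > 0` if the dual center `ν` lies to
the left of the dual edge directed from `i` to `j`, and `κ < 0` if it lies to the right. -/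
theorem exists_dualCenter_eq {e : E} {i j : I} {ν : N} (hij : i ≠ j)
    (h : (M.CE e : Set I) = {i, j}) (hν : ν ∈ M.VE e) :
    ∃ κ : ℝ, κ ≠ 0 ∧ M.dualCenter ν = M.mid e + κ * Complex.I * (M.center j - M.center i) := by
  obtain ⟨t, ht0, ht1, hmid⟩ := exists_mid_eq hij h
  have hv := center_sub_center_ne_zero (M := M) hij
  have hi : i ∈ M.CE e := Finset.mem_coe.1 (h ▸ mem_insert i _)
  have horth := M.orthogonal e i hi ν hν
  have h1 : M.center i - M.mid e = (-t : ℝ) • (M.center j - M.center i) := by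
    rw [hmid, Complex.real_smul]; push_cast; ring
  rw [h1, real_inner_smul_left, mul_eq_zero] at horth
  obtain ⟨κ, hκ⟩ := Complex.eq_mul_I_mul_of_inner_eq_zero hv
    (horth.resolve_left (neg_ne_zero.2 ht0.ne'))
  refine ⟨κ, ?_, by rw [← hκ]; ring⟩
  rintro rfl
  exact M.dualCenter_ne_mid (sub_eq_zero.1 (by rw [hκ]; simp) : M.dualCenter ν = M.mid e)

/-- The normal vector of the primary edge is parallel to the dual edge. -/
theorem normal_eq {e : E} {i j : I} (hij : i ≠ j) (h : (M.CE e : Set I) = {i, j}) :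
    ∃ c : ℝ, c ≠ 0 ∧ M.normal e = c * (M.center j - M.center i) := by
  obtain ⟨ν, hν⟩ := M.exists_mem_VE e
  obtain ⟨κ, hκ, hy⟩ := exists_dualCenter_eq hij h hν
  have hv := center_sub_center_ne_zero (M := M) hij
  have hn := M.normal_orthogonal e ν hν
  rw [hy, add_sub_cancel_left, real_inner_comm] at hn
  have hκ' : (κ : ℂ) ≠ 0 := Complex.ofReal_ne_zero.2 hκ
  obtain ⟨c, hc⟩ := Complex.eq_mul_I_mul_of_inner_eq_zero
    (mul_ne_zero (mul_ne_zero hκ' Complex.I_ne_zero) hv) hn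
  have hc' : M.normal e = (-(c * κ) : ℝ) * (M.center j - M.center i) := by
    rw [hc]
    push_cast
    linear_combination (c : ℂ) * κ * (M.center j - M.center i) * Complex.I_mul_I
  refine ⟨_, fun h0 => ?_, hc'⟩
  have := M.norm_normal e
  rw [hc', h0] at this
  simp at this

theorem normalSign_eq {e : E} {i j : I} (hij : i ≠ j) (h : (M.CE e : Set I) = {i, j}) {c : ℝ}
    (hc : M.normal e = c * (M.center j - M.center i)) :
    M.normalSign e i = if 0 < c then 1 else -1 := by
  obtain ⟨t, ht0, ht1, hmid⟩ := exists_mid_eq hij h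
  have hv := center_sub_center_ne_zero (M := M) hij
  have h1 : M.mid e - M.center i = t • (M.center j - M.center i) := by
    rw [hmid, Complex.real_smul]; ring
  have h2 : inner ℝ (M.normal e) (M.mid e - M.center i) =
      c * (t * ‖M.center j - M.center i‖ ^ 2) := by
    rw [hc, h1, ← Complex.real_smul, real_inner_smul_left, real_inner_smul_right,
      real_inner_self_eq_norm_sq]
  have h3 : 0 < t * ‖M.center j - M.center i‖ ^ 2 :=
    mul_pos ht0 (pow_pos (norm_pos_iff.2 hv) 2)
  rw [MeshData.normalSign, h2]
  simp only [mul_pos_iff_of_pos_right h3]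

theorem normalSign_add_normalSign {e : E} {i j : I} (hij : i ≠ j)
    (h : (M.CE e : Set I) = {i, j}) : M.normalSign e i + M.normalSign e j = 0 := by
  obtain ⟨c, hc0, hc⟩ := normal_eq hij h
  rw [normalSign_eq hij h hc, normalSign_eq hij.symm (by rw [h, pair_comm]) (c := -c)
    (by rw [hc]; push_cast; ring)]
  rcases lt_or_gt_of_ne hc0 with h | h
  · simp [h, h.not_gt]
  · simp [h, h.not_gt]

/-- The product of the two direction indicators only depends on the side of the directed dual edge
on which the dual center lies. -/
theorem normalSign_mul_tangentSign {e : E} {i j : I} {ν : N} (hij : i ≠ j)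
    (h : (M.CE e : Set I) = {i, j}) {κ : ℝ} (hκ0 : κ ≠ 0)
    (hκ : M.dualCenter ν = M.mid e + κ * Complex.I * (M.center j - M.center i)) :
    M.normalSign e i * M.tangentSign e ν = if 0 < κ then -1 else 1 := by
  obtain ⟨c, hc0, hc⟩ := normal_eq hij h
  have hv := center_sub_center_ne_zero (M := M) hij
  have h1 : M.mid e - M.dualCenter ν =
      (-κ) • (Complex.I * (M.center j - M.center i)) := by
    rw [hκ, Complex.real_smul]; push_cast; ring
  have h2 : M.tangent e = c • (Complex.I * (M.center j - M.center i)) := by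
    rw [MeshData.tangent, hc, Complex.real_smul]; ring
  have h3 : inner ℝ (M.tangent e) (M.mid e - M.dualCenter ν) =
      -(c * κ) * ‖Complex.I * (M.center j - M.center i)‖ ^ 2 := by
    rw [h1, h2, real_inner_smul_left, real_inner_smul_right, real_inner_self_eq_norm_sq]
    ring
  have h4 : 0 < ‖Complex.I * (M.center j - M.center i)‖ ^ 2 :=
    pow_pos (norm_pos_iff.2 (mul_ne_zero Complex.I_ne_zero hv)) 2
  rw [normalSign_eq hij h hc, MeshData.tangentSign, h3]
  simp only [mul_pos_iff_of_pos_right h4, Left.neg_pos_iff]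
  rcases lt_or_gt_of_ne hc0 with hc | hc <;> rcases lt_or_gt_of_ne hκ0 with hκ | hκ
  · simp [hc.not_gt, hκ.not_gt, (mul_pos_of_neg_of_neg hc hκ).not_gt]
  · simp [hc.not_gt, hκ, mul_neg_of_neg_of_pos hc hκ]
  · simp [hc, hκ.not_gt, mul_neg_of_pos_of_neg hc hκ]
  · simp [hc, hκ, (mul_pos hc hκ).not_gt]

/-! ### The two sides of a dual edge -/

/-- On both sides of a dual edge, sufficiently thin triangles avoid all dual edges. -/
theorem exists_forall_disjoint_thinTriangle_dualEdge {e : E} {i j : I} (hij : i ≠ j)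
    (h : (M.CE e : Set I) = {i, j}) :
    ∃ ε₀ > 0, ∀ ε : ℝ, ε ≠ 0 → |ε| ≤ ε₀ →
      ∀ e', Disjoint (thinTriangle (M.center i) (M.center j) ε) (M.dualEdge e') := by
  have hab : M.center i ≠ M.center j := M.center_injective.ne hij
  have hone : ∀ e', ∃ ε₀ > 0, ∀ ε : ℝ, ε ≠ 0 → |ε| ≤ ε₀ →
      Disjoint (thinTriangle (M.center i) (M.center j) ε) (M.dualEdge e') := by
    intro e'
    by_cases hee : e' = e
    · subst hee
      rw [dualEdge_eq_segment h]
      exact ⟨1, one_pos, fun ε hε _ => disjoint_thinTriangle_segment hab hε⟩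
    · obtain ⟨k, l, -, hCE, -⟩ := M.CE_spec e'
      have hsub : segment ℝ (M.center k) (M.center l) ∩ segment ℝ (M.center i) (M.center j) ⊆
          {M.center i, M.center j} := by
        rw [← dualEdge_eq_segment h, ← dualEdge_eq_segment hCE, ← image_pair, ← h]
        exact (M.dualEdge_inter e' e hee).trans (image_mono fun m hm => hm.2)
      obtain ⟨ε₀, h0, hε⟩ := exists_thinTriangle_disjoint_segment hab hsub
      rw [dualEdge_eq_segment hCE]
      exact ⟨ε₀, h0, fun ε _ h => hε ε h⟩
  choose f hf0 hf using hone
  have : Nonempty E := ⟨e⟩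
  obtain ⟨e₀, he₀⟩ := Finite.exists_min f
  exact ⟨f e₀, hf0 e₀, fun ε h0 hε e' => hf e' ε h0 (hε.trans (he₀ e'))⟩

/-- The thin triangle on the side of the dual edge where the dual center `ν` lies is part of the
dual cell `ν`. -/
theorem thinTriangle_subset_dualCell {e : E} {i j : I} {ν : N} (hij : i ≠ j)
    (h : (M.CE e : Set I) = {i, j}) (hν : ν ∈ M.VE e) {κ ε : ℝ}
    (hκ : M.dualCenter ν = M.mid e + κ * Complex.I * (M.center j - M.center i))
    (hε : 0 < κ * ε)
    (hdisj : ∀ e', Disjoint (thinTriangle (M.center i) (M.center j) ε) (M.dualEdge e')) :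
    thinTriangle (M.center i) (M.center j) ε ⊆ M.dualCell ν ∧
      ∀ s ∈ Ioc (0 : ℝ) 1,
        M.mid e + s * (κ * Complex.I * (M.center j - M.center i)) ∈ M.dualCell ν := by
  obtain ⟨t, ht0, ht1, hmid⟩ := exists_mid_eq hij h
  have hopen := (M.isPolygonalCell_dualCell ν).isOpen
  have hab : M.center i ≠ M.center j := M.center_injective.ne hij
  have hκ0 : κ ≠ 0 := by rintro rfl; simp at hε
  -- the half-open primary edge avoids all dual edges
  have hedge : ∀ s ∈ Ioc (0 : ℝ) 1, ∀ e',
      M.mid e + s * (κ * Complex.I * (M.center j - M.center i)) ∉ M.dualEdge e' := by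
    intro s hs e' hmem
    have hprim : M.mid e + s * (κ * Complex.I * (M.center j - M.center i)) ∈ M.primaryEdge e := by
      refine (convex_convexHull ℝ _).segment_subset (M.mid_mem_primaryEdge e)
        (M.dualCenter_mem_primaryEdge hν) ?_
      rw [segment_eq_image']
      exact ⟨s, ⟨hs.1.le, hs.2⟩, by simp [hκ]⟩
    by_cases hee : e = e'
    · subst hee
      rw [dualEdge_eq_segment h, segment_eq_image'] at hmem
      obtain ⟨r, -, hr⟩ := hmem
      have h0 : (M.center j - M.center i) * (r - (t + s * κ * Complex.I)) = 0 := by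
        simp only [Complex.real_smul, hmid] at hr
        linear_combination hr
      rcases mul_eq_zero.1 h0 with h0 | h0
      · exact hab (sub_eq_zero.1 h0).symm
      · have := congrArg Complex.im h0
        simp at this
        rcases this with h1 | h1
        · exact hs.1.ne' h1
        · exact hκ0 h1
    · exact disjoint_left.1 (M.edge_disjoint e e' hee) hprim hmem
  have hhalf : ∀ s ∈ Ioc (0 : ℝ) 1,
      M.mid e + s * (κ * Complex.I * (M.center j - M.center i)) ∈ M.dualCell ν := by
    have hpre : IsPreconnected ((fun s : ℝ =>
        M.mid e + s * (κ * Complex.I * (M.center j - M.center i))) '' Ioc 0 1) :=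
      isPreconnected_Ioc.image _ (by fun_prop)
    have hd : Disjoint ((fun s : ℝ =>
        M.mid e + s * (κ * Complex.I * (M.center j - M.center i))) '' Ioc 0 1)
        (frontier (M.dualCell ν)) := by
      refine disjoint_left.2 ?_
      rintro _ ⟨s, hs, rfl⟩ hz
      obtain ⟨e', he'⟩ := mem_iUnion.1 (M.frontier_dualCell_subset ν hz)
      exact hedge s hs e' he'
    rcases hpre.subset_or_disjoint_closure hopen hd with h | h
    · exact fun s hs => h ⟨s, hs, rfl⟩
    · refine absurd (subset_closure (M.dualCenter_mem ν)) (disjoint_left.1 h ?_)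
      exact ⟨1, ⟨one_pos, le_rfl⟩, by simp [hκ]⟩
  refine ⟨?_, hhalf⟩
  have hd : Disjoint (thinTriangle (M.center i) (M.center j) ε) (frontier (M.dualCell ν)) := by
    refine disjoint_left.2 fun z hz hz' => ?_
    obtain ⟨e', he'⟩ := mem_iUnion.1 (M.frontier_dualCell_subset ν hz')
    exact disjoint_left.1 (hdisj e') hz he'
  refine ((isPreconnected_thinTriangle _ _ _).subset_or_disjoint_closure hopen hd).resolve_right
    fun hcl => ?_
  obtain ⟨s, hs1, hs2⟩ := ((eventually_mem_thinTriangle (M.center i) (M.center j) ht0 ht1 hε).and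
    (Ioc_mem_nhdsGT one_pos)).exists
  rw [← hmid] at hs1
  exact disjoint_left.1 hcl hs1 (subset_closure (hhalf s hs2))

/-- The thin triangle on the other side of the dual edge misses the dual cell. -/
theorem disjoint_thinTriangle_closure_dualCell {e : E} {i j : I} {ν : N} (hij : i ≠ j)
    (h : (M.CE e : Set I) = {i, j}) (hν : ν ∈ M.VE e) {κ ε : ℝ}
    (hκ : M.dualCenter ν = M.mid e + κ * Complex.I * (M.center j - M.center i))
    (hε : κ * ε < 0)
    (hdisj : ∀ e', Disjoint (thinTriangle (M.center i) (M.center j) ε) (M.dualEdge e'))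
    (hdisj' : ∀ e', Disjoint (thinTriangle (M.center i) (M.center j) (-ε)) (M.dualEdge e')) :
    Disjoint (thinTriangle (M.center i) (M.center j) ε) (closure (M.dualCell ν)) := by
  obtain ⟨t, ht0, ht1, hmid⟩ := exists_mid_eq hij h
  have hopen := (M.isPolygonalCell_dualCell ν).isOpen
  have hab : M.center i ≠ M.center j := M.center_injective.ne hij
  have hd : Disjoint (thinTriangle (M.center i) (M.center j) ε) (frontier (M.dualCell ν)) := by
    refine disjoint_left.2 fun z hz hz' => ?_
    obtain ⟨e', he'⟩ := mem_iUnion.1 (M.frontier_dualCell_subset ν hz')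
    exact disjoint_left.1 (hdisj e') hz he'
  refine ((isPreconnected_thinTriangle _ _ _).subset_or_disjoint_closure hopen hd).resolve_left
    fun hsub => ?_
  have hsub' := (thinTriangle_subset_dualCell hij h hν hκ (by linarith) hdisj').1
  -- otherwise the cell would lie on both sides of the dual edge
  have hfr := M.dualEdge_subset_frontier hν
  refine (M.isPolygonalCell_dualCell ν).closure_notMem_nhds (hfr (M.mid_mem_dualEdge e)) ?_
  have hseg : segment ℝ (M.center i) (M.center j) ⊆ closure (M.dualCell ν) := by
    rw [← dualEdge_eq_segment h]
    exact hfr.trans frontier_subset_closure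
  have hε0 : ε ≠ 0 := by rintro rfl; simp at hε
  have hloc := eventually_mem_thinTriangle_or_mem_segment hab ht0 ht1 (abs_pos.2 hε0)
  rw [← hmid] at hloc
  have hboth : thinTriangle (M.center i) (M.center j) |ε| ∪
      thinTriangle (M.center i) (M.center j) (-|ε|) ⊆ M.dualCell ν := by
    rcases abs_choice ε with h | h
    · rw [h]; exact union_subset hsub hsub'
    · rw [h, neg_neg]; exact union_subset hsub' hsub
  filter_upwards [hloc] with z hz
  rcases hz with hz | hz
  · exact subset_closure (hboth hz)
  · exact hseg hz

/-- Beyond a dual edge on the boundary there is no point of the domain. -/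
theorem disjoint_thinTriangle_closure_domain (hΩ : IsOpen Ω) {e : E} {i j : I} {ν : N}
    (he : e ∈ M.bdryEdge) (hij : i ≠ j)
    (h : (M.CE e : Set I) = {i, j}) (hν : ν ∈ M.VE e) {κ ε : ℝ}
    (hκ : M.dualCenter ν = M.mid e + κ * Complex.I * (M.center j - M.center i))
    (hε : κ * ε < 0)
    (hdisj : ∀ e', Disjoint (thinTriangle (M.center i) (M.center j) ε) (M.dualEdge e'))
    (hdisj' : ∀ e', Disjoint (thinTriangle (M.center i) (M.center j) (-ε)) (M.dualEdge e')) :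
    Disjoint (thinTriangle (M.center i) (M.center j) ε) (closure Ω) := by
  obtain ⟨t, ht0, ht1, hmid⟩ := exists_mid_eq hij h
  have hνcl := disjoint_thinTriangle_closure_dualCell hij h hν hκ hε hdisj hdisj'
  have hd : Disjoint (thinTriangle (M.center i) (M.center j) ε) (frontier Ω) := by
    refine disjoint_left.2 fun z hz hz' => ?_
    obtain ⟨e', he'⟩ := mem_iUnion.1 (M.frontier_domain_subset hz')
    exact disjoint_left.1 (hdisj e') hz he'
  refine ((isPreconnected_thinTriangle _ _ _).subset_or_disjoint_closure hΩ hd).resolve_left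
    fun hsub => ?_
  -- otherwise another dual cell would lie beyond the edge, and border it
  have hcov : ∃ μ, μ ≠ ν ∧ M.mid e ∈ closure (M.dualCell μ) := by
    have hmem : M.mid e ∈ closure (⋃ μ ∈ {μ | μ ≠ ν}, closure (M.dualCell μ)) := by
      have hT : M.mid e ∈ closure (thinTriangle (M.center i) (M.center j) ε) := by
        refine mem_closure_of_tendsto (b := 𝓝[>] (0 : ℝ))
          (f := fun s : ℝ => M.center i + (M.center j - M.center i) * t +
            s * ((-κ : ℝ) * Complex.I * (M.center j - M.center i))) ?_
          (eventually_mem_thinTriangle _ _ ht0 ht1 (by linarith))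
        have : Continuous (fun s : ℝ => M.center i + (M.center j - M.center i) * t +
            s * ((-κ : ℝ) * Complex.I * (M.center j - M.center i))) := by fun_prop
        exact (this.tendsto' 0 _ (by simp [hmid])).mono_left nhdsWithin_le_nhds
      refine closure_mono (fun z hz => ?_) hT
      have : z ∈ ⋃ μ, closure (M.dualCell μ) := by
        rw [M.closure_dualCell]; exact subset_closure (hsub hz)
      obtain ⟨μ, hμ⟩ := mem_iUnion.1 this
      refine mem_biUnion (x := μ) ?_ hμ
      rintro rfl
      exact disjoint_left.1 hνcl hz hμ
    rw [IsClosed.closure_eq ((Set.toFinite _).isClosed_biUnion fun _ _ => isClosed_closure)]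
      at hmem
    simpa using hmem
  obtain ⟨μ, hμν, hμ⟩ := hcov
  have hfr : M.mid e ∈ frontier (M.dualCell μ) := by
    rw [(M.isPolygonalCell_dualCell μ).isOpen.frontier_eq]
    exact ⟨hμ, disjoint_left.1 (M.disjoint_dualEdge_dualCell e μ) (M.mid_mem_dualEdge e)⟩
  rw [M.frontier_dualCell] at hfr
  simp only [mem_iUnion, exists_prop] at hfr
  obtain ⟨e', he', hmem⟩ := hfr
  rw [M.mid_mem_dualEdge_iff] at hmem
  subst hmem
  obtain ⟨ν', hν'⟩ := M.VE_bdry e he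
  have h1 : μ ∈ (M.VE e : Set N) := he'
  have h2 : ν ∈ (M.VE e : Set N) := hν
  rw [hν'] at h1 h2
  exact hμν (h1.trans h2.symm)

end StaggeredMesh

section Rays
open Filter Topology

theorem eq_norm_mul_exp_of_mem_angleRay {x v : ℂ} {s θ : ℝ} (hs : 0 < s)
    (h : x + s * v ∈ angleRay x θ) : v = ‖v‖ * Complex.exp (θ * Complex.I) := by
  obtain ⟨ρ, hρ, h⟩ := h
  have h1 : (s : ℂ) * v = ρ * Complex.exp (θ * Complex.I) := add_left_cancel h
  have h2 : s * ‖v‖ = ρ := by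
    rw [← norm_ofReal_mul_exp_mul_I hρ θ, ← h1, norm_mul, Complex.norm_real,
      Real.norm_of_nonneg hs.le]
  have h3 : (s : ℂ) ≠ 0 := Complex.ofReal_ne_zero.2 hs.ne'
  rw [← h2] at h1
  push_cast at h1
  rw [mul_assoc] at h1
  exact mul_left_cancel₀ h3 h1

end Rays

namespace StaggeredMesh
open Filter Topology

variable {Ω : Set ℂ} {I N E : Type*} [Fintype I] [Fintype N] [Fintype E]
  (M : StaggeredMesh Ω I N E)

/-! ### The divergence of a skew gradient -/

theorem cellArea_pos (i : I) : 0 < M.cellArea i := by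
  have hC := M.isPolygonalCell_cell i
  refine ENNReal.toReal_pos (hC.isOpen.measure_pos volume hC.isConnected.nonempty).ne' ?_
  exact hC.isBounded.measure_lt_top.ne

theorem primaryLength_pos (e : E) : 0 < M.primaryLength e := by
  obtain ⟨ν, hν⟩ := M.exists_mem_VE e
  have hb : Bornology.IsBounded (M.primaryEdge e) :=
    (((toFinite _).insert _).isCompact_convexHull ℝ).isBounded
  exact (dist_pos.2 M.dualCenter_ne_mid).trans_le
    (Metric.dist_le_diam_of_mem hb (M.dualCenter_mem_primaryEdge hν) (M.mid_mem_primaryEdge e))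

theorem divergence_eq_zero_iff (u : M.VectorField) :
    M.divergence u = 0 ↔
      ∀ i, ∑ e ∈ M.EC i, u e * M.primaryLength e * M.normalSign e i = 0 := by
  refine funext_iff.trans (forall_congr' fun i => ?_)
  simp [divergence, (M.cellArea_pos i).ne']

theorem eq_skewGradient_iff (u : M.VectorField) (ψ : M.DualScalarField) :
    u = M.skewGradient ψ ↔
      ∀ e, u e * M.primaryLength e = ∑ ν ∈ M.VE e, ψ ν * M.tangentSign e ν := by
  refine funext_iff.trans (forall_congr' fun e => ?_)
  rw [skewGradient, one_div, inv_mul_eq_div, eq_div_iff (M.primaryLength_pos e).ne']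

/-- The dual edge `e` leaves the center of the primary cell `i` in the direction `θ`. -/
def LeavesAt (e : E) (i : I) (θ : ℝ) : Prop :=
  ∃ j, i ≠ j ∧ (M.CE e : Set I) = {i, j} ∧
    M.center j - M.center i = ‖M.center j - M.center i‖ * Complex.exp (θ * Complex.I)

variable {M}

theorem leavesAt_of_mem {e : E} {i : I} {θ : ℝ} {z : ℂ} (hi : i ∈ M.CE e) (hz : z ∈ M.dualEdge e)
    (hne : z ≠ M.center i) (hθ : z ∈ angleRay (M.center i) θ) : M.LeavesAt e i θ := by
  obtain ⟨j, hij, hCE⟩ := M.exists_CE_eq hi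
  rw [dualEdge_eq_segment hCE, segment_eq_image'] at hz
  obtain ⟨s, hs, rfl⟩ := hz
  have hs0 : 0 < s := by
    refine lt_of_le_of_ne hs.1 ?_
    rintro rfl
    simp at hne
  refine ⟨j, hij, hCE, eq_norm_mul_exp_of_mem_angleRay (x := M.center i) hs0 ?_⟩
  simpa using hθ

/-- Two dual edges leaving a center in the same direction coincide. -/
theorem LeavesAt.unique {e e' : E} {i : I} {θ : ℝ} (h : M.LeavesAt e i θ)
    (h' : M.LeavesAt e' i θ) : e = e' := by
  wlog hle : ∀ j j', (M.CE e : Set I) = {i, j} → (M.CE e' : Set I) = {i, j'} → i ≠ j → i ≠ j' →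
      ‖M.center j - M.center i‖ ≤ ‖M.center j' - M.center i‖ generalizing e e'
  · push Not at hle
    obtain ⟨j, j', h1, h2, h3, h4, hlt⟩ := hle
    refine (this h' h fun k k' hk hk' hik hik' => ?_).symm
    rw [h2] at hk
    rw [h1] at hk'
    obtain rfl : j' = k := by
      rcases pair_eq_pair_iff.1 hk with ⟨-, h⟩ | ⟨h, -⟩
      · exact h
      · exact absurd h hik
    obtain rfl : j = k' := by
      rcases pair_eq_pair_iff.1 hk' with ⟨-, h⟩ | ⟨h, -⟩
      · exact h
      · exact absurd h hik'
    exact hlt.le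
  obtain ⟨j, hij, hCE, hj⟩ := h
  obtain ⟨j', hij', hCE', hj'⟩ := h'
  have hnorm := hle j j' hCE hCE' hij hij'
  have hpos : 0 < ‖M.center j' - M.center i‖ :=
    norm_pos_iff.2 (center_sub_center_ne_zero hij')
  rw [← M.mid_mem_dualEdge_iff, dualEdge_eq_segment hCE']
  have hmid := M.mid_mem_dualEdge e
  rw [dualEdge_eq_segment hCE] at hmid
  refine (convex_segment (𝕜 := ℝ) _ _).segment_subset (left_mem_segment ℝ _ _) ?_ hmid
  -- the shorter edge ends on the longer one
  rw [segment_eq_image']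
  refine ⟨‖M.center j - M.center i‖ / ‖M.center j' - M.center i‖,
    ⟨by positivity, (div_le_one hpos).2 hnorm⟩, ?_⟩
  have hpos' : (‖M.center j' - M.center i‖ : ℂ) ≠ 0 := Complex.ofReal_ne_zero.2 hpos.ne'
  dsimp only
  rw [Complex.real_smul, hj']
  conv_rhs => rw [← add_sub_cancel (M.center i) (M.center j), hj]
  rw [norm_ofReal_mul_exp_mul_I (norm_nonneg _)]
  push_cast
  field_simp

/-- Every dual edge close to a center ends there. -/
theorem exists_ball_forall_mem_dualEdge (M : StaggeredMesh Ω I N E) (i : I) :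
    ∃ r > 0, ∀ e, ∀ z ∈ Metric.ball (M.center i) r, z ∈ M.dualEdge e → i ∈ M.CE e := by
  obtain ⟨r, hr, h⟩ :=
    exists_ball_forall_mem_imp (fun e => (M.isCompact_dualEdge e).isClosed) (M.center i)
  exact ⟨r, hr, fun e z hz hze => M.mem_CE_of_center_mem_dualEdge (h e z hz hze)⟩

open Classical in
/-- The boundary of a boundary vanishes: at a vertex of the dual cell `ν` exactly two of its edges
meet, with the cell to the left of one and to the right of the other. -/
theorem sum_normalSign_mul_tangentSign (M : StaggeredMesh Ω I N E) (i : I) (ν : N) :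
    ∑ e ∈ M.EC i with ν ∈ M.VE e, M.normalSign e i * M.tangentSign e ν = 0 := by
  rcases Finset.eq_empty_or_nonempty {e ∈ M.EC i | ν ∈ M.VE e} with h0 | ⟨e₀, he₀⟩
  · rw [h0, Finset.sum_empty]
  have hmem : ∀ e, e ∈ ({e ∈ M.EC i | ν ∈ M.VE e} : Finset E) ↔ i ∈ M.CE e ∧ ν ∈ M.VE e := by
    intro e
    rw [Finset.mem_filter, M.mem_EC]
  rw [hmem] at he₀
  have hcell := M.isPolygonalCell_dualCell ν
  obtain ⟨α, β, r, hr, hαβ, hβ, hfr, hsec⟩ := hcell.exists_inter_ball_eq_sector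
    (M.dualEdge_subset_frontier he₀.2 (M.center_mem_dualEdge he₀.1))
  obtain ⟨r₀, hr₀, hnear⟩ := M.exists_ball_forall_mem_dualEdge i
  have hsub : sector (M.center i) α β r ⊆ M.dualCell ν := fun z hz => (hsec.ge hz).1
  have hsign : ∀ e, ν ∈ M.VE e → ∀ σ θ : ℝ, |σ| = 1 →
      (∀ᶠ δ : ℝ in 𝓝[>] 0, θ + σ * δ ∈ Ioo α β) → M.LeavesAt e i θ →
      M.normalSign e i * M.tangentSign e ν = -σ := by
    rintro e hν σ θ hσ hev ⟨j, hij, hCE, hj⟩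
    obtain ⟨κ, hκ0, hκ⟩ := exists_dualCenter_eq hij hCE hν
    obtain ⟨ε₀, hε₀, hdisj⟩ := exists_forall_disjoint_thinTriangle_dualEdge hij hCE
    have hσ0 : σ ≠ 0 := by rintro rfl; simp at hσ
    have hσσ : 0 < σ * σ := mul_self_pos.2 hσ0
    have hne : σ * ε₀ ≠ 0 := mul_ne_zero hσ0 hε₀.ne'
    have habs : |σ * ε₀| ≤ ε₀ := by rw [abs_mul, hσ, one_mul, abs_of_pos hε₀]
    obtain ⟨z, hz1, hz2⟩ := sector_inter_thinTriangle_nonempty (r := r) (ε := σ * ε₀)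
      (M.center_injective.ne hij) hr hj (by rw [← mul_assoc]; exact mul_pos hσσ hε₀) hev hσ
    have hκσ : 0 < κ * σ := by
      by_contra hle
      have hlt : κ * σ < 0 := lt_of_le_of_ne (not_lt.1 hle) (mul_ne_zero hκ0 hσ0)
      refine disjoint_left.1 (disjoint_thinTriangle_closure_dualCell hij hCE hν hκ
        (by rw [← mul_assoc]; exact mul_neg_of_neg_of_pos hlt hε₀) (hdisj _ hne habs)
        (hdisj _ (neg_ne_zero.2 hne) (by rwa [abs_neg]))) hz2 (subset_closure (hsub hz1))
    rw [normalSign_mul_tangentSign hij hCE hκ0 hκ]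
    rcases (abs_eq zero_le_one).1 hσ with rfl | rfl
    · rw [if_pos (by linarith)]
    · rw [if_neg (by linarith), neg_neg]
  have hα : ∀ e, ν ∈ M.VE e → M.LeavesAt e i α →
      M.normalSign e i * M.tangentSign e ν = -1 := fun e hν he =>
    hsign e hν 1 α abs_one (by
      filter_upwards [Ioo_mem_nhdsGT (sub_pos.2 hαβ)] with δ hδ
      exact ⟨by linarith [hδ.1], by linarith [hδ.2]⟩) he
  have hβ' : ∀ e, ν ∈ M.VE e → M.LeavesAt e i β →
      M.normalSign e i * M.tangentSign e ν = - -1 := fun e hν he =>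
    hsign e hν (-1) β (by simp) (by
      filter_upwards [Ioo_mem_nhdsGT (sub_pos.2 hαβ)] with δ hδ
      exact ⟨by linarith [hδ.2], by linarith [hδ.1]⟩) he
  -- each edge follows one of the two bounding rays of the sector
  have hdir : ∀ e, i ∈ M.CE e → ν ∈ M.VE e → M.LeavesAt e i α ∨ M.LeavesAt e i β := by
    intro e hi hν
    obtain ⟨j, hij, hCE⟩ := M.exists_CE_eq hi
    have hlim : Tendsto (fun s : ℝ => M.center i + s * (M.center j - M.center i)) (𝓝[>] 0)
        (𝓝 (M.center i)) := by
      have : Continuous (fun s : ℝ => M.center i + s * (M.center j - M.center i)) := by fun_prop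
      exact (this.tendsto' 0 _ (by simp)).mono_left nhdsWithin_le_nhds
    obtain ⟨s, hs1, hs2⟩ := ((hlim.eventually (Metric.ball_mem_nhds _ hr)).and
      (Ioc_mem_nhdsGT one_pos)).exists
    have hz : M.center i + s * (M.center j - M.center i) ∈ M.dualEdge e := by
      rw [dualEdge_eq_segment hCE, segment_eq_image']
      exact ⟨s, ⟨hs2.1.le, hs2.2⟩, by simp⟩
    have hne : M.center i + s * (M.center j - M.center i) ≠ M.center i := by
      simpa [hs2.1.ne'] using center_sub_center_ne_zero (M := M) hij
    rcases hfr ⟨M.dualEdge_subset_frontier hν hz, hs1⟩ with h | h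
    · exact Or.inl (leavesAt_of_mem hi hz hne h)
    · exact Or.inr (leavesAt_of_mem hi hz hne h)
  -- each bounding ray is followed by an edge
  have hex : ∀ θ ∈ ({α, β} : Set ℝ), ∃ e, i ∈ M.CE e ∧ ν ∈ M.VE e ∧ M.LeavesAt e i θ := by
    intro θ hθ
    set ρ := min r r₀ / 2 with hρ
    have hρ0 : 0 < ρ := by positivity
    have hρr : ρ < r := by have := min_le_left r r₀; linarith [lt_min hr hr₀]
    have hρr₀ : ρ < r₀ := by have := min_le_right r r₀; linarith [lt_min hr hr₀]
    set z := M.center i + ρ * Complex.exp (θ * Complex.I) with hz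
    have hdist : dist z (M.center i) = ρ := by
      rw [dist_eq_norm, hz, add_sub_cancel_left, norm_ofReal_mul_exp_mul_I hρ0.le]
    have hzball : z ∈ Metric.ball (M.center i) r := by rw [Metric.mem_ball, hdist]; exact hρr
    have hzray : z ∈ angleRay (M.center i) θ := ⟨ρ, hρ0.le, rfl⟩
    have hzrays : z ∈ angleRay (M.center i) α ∪ angleRay (M.center i) β := by
      rcases hθ with rfl | rfl
      · exact Or.inl hzray
      · exact Or.inr hzray
    have hzfr : z ∈ frontier (M.dualCell ν) := by
      rw [hcell.isOpen.frontier_eq]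
      refine ⟨closure_mono hsub (mem_closure_sectors hαβ hβ hzball hzrays).1, fun hzC => ?_⟩
      exact disjoint_left.1 (disjoint_sector_angleRay hαβ hβ) (hsec.le ⟨hzC, hzball⟩) hzrays
    rw [M.frontier_dualCell] at hzfr
    simp only [mem_iUnion, exists_prop] at hzfr
    obtain ⟨e, he, hze⟩ := hzfr
    have hi := hnear e z (by rw [Metric.mem_ball, hdist]; exact hρr₀) hze
    exact ⟨e, hi, he, leavesAt_of_mem hi hze (dist_pos.1 (hdist ▸ hρ0)) hzray⟩
  obtain ⟨e₁, hi₁, hν₁, hl₁⟩ := hex α (Or.inl rfl)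
  obtain ⟨e₂, hi₂, hν₂, hl₂⟩ := hex β (Or.inr rfl)
  have hne : e₁ ≠ e₂ := by
    rintro rfl
    have := (hα e₁ hν₁ hl₁).symm.trans (hβ' e₁ hν₁ hl₂)
    norm_num at this
  have hset : ({e ∈ M.EC i | ν ∈ M.VE e} : Finset E) = {e₁, e₂} := by
    ext e
    rw [hmem, Finset.mem_insert, Finset.mem_singleton]
    constructor
    · rintro ⟨hi, hν⟩
      exact (hdir e hi hν).imp (fun h => h.unique hl₁) fun h => h.unique hl₂
    · rintro (rfl | rfl)
      · exact ⟨hi₁, hν₁⟩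
      · exact ⟨hi₂, hν₂⟩
  rw [hset, Finset.sum_pair hne, hα e₁ hν₁ hl₁, hβ' e₂ hν₂ hl₂]
  ring

/-- A skew gradient is divergence-free, as the boundary of a boundary vanishes. -/
theorem divergence_skewGradient (M : StaggeredMesh Ω I N E) (ψ : M.DualScalarField) :
    M.divergence (M.skewGradient ψ) = 0 := by
  classical
  rw [divergence_eq_zero_iff]
  intro i
  have h := (M.eq_skewGradient_iff (M.skewGradient ψ) ψ).1 rfl
  calc ∑ e ∈ M.EC i, M.skewGradient ψ e * M.primaryLength e * M.normalSign e i
      = ∑ e ∈ M.EC i, ∑ ν, if ν ∈ M.VE e then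
          ψ ν * (M.normalSign e i * M.tangentSign e ν) else 0 := by
        refine Finset.sum_congr rfl fun e _ => ?_
        rw [h, Finset.sum_mul, ← Finset.sum_filter]
        refine Finset.sum_congr (by ext; simp) fun ν _ => by ring
    _ = ∑ ν, ψ ν * ∑ e ∈ M.EC i with ν ∈ M.VE e, M.normalSign e i * M.tangentSign e ν := by
        rw [Finset.sum_comm]
        refine Finset.sum_congr rfl fun ν _ => ?_
        rw [← Finset.sum_filter, Finset.mul_sum]
    _ = 0 := by simp [sum_normalSign_mul_tangentSign]

end StaggeredMesh

section Logarithms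
open Filter Topology

/-! ### Branches of the logarithm -/

/-- The principal logarithm of `(b - w) / (a - w)` is holomorphic in `w` off the segment
`[a, b]`. -/
theorem div_mem_slitPlane_of_notMem_segment {a b w : ℂ} (h : w ∉ segment ℝ a b) :
    (b - w) / (a - w) ∈ Complex.slitPlane := by
  have ha : a - w ≠ 0 := sub_ne_zero.2 fun h' => h (h' ▸ left_mem_segment ℝ a b)
  by_contra hs
  rw [Complex.mem_slitPlane_iff, not_or, not_lt, not_not] at hs
  obtain ⟨hre, him⟩ := hs
  set ρ := -((b - w) / (a - w)).re with hρ
  have hρ0 : 0 ≤ ρ := by linarith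
  have hq : (b - w) / (a - w) = (-ρ : ℝ) := by
    apply Complex.ext
    · simp [hρ]
    · simpa using him
  have hb : b - w = (-ρ : ℝ) * (a - w) := by rw [← hq]; field_simp
  refine h ?_
  rw [segment_eq_image']
  have h1 : (1 + ρ : ℂ) ≠ 0 := by exact_mod_cast (by positivity : (1 + ρ : ℝ) ≠ 0)
  refine ⟨1 / (1 + ρ), ⟨by positivity, (div_le_one (by positivity)).2 (by linarith)⟩, ?_⟩
  dsimp only
  rw [Complex.real_smul]
  push_cast at hb ⊢
  field_simp
  linear_combination hb

theorem IsPreconnected.eq_of_exp_eq {S : Set ℂ} (hS : IsPreconnected S) {f : ℂ → ℂ}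
    (hf : ContinuousOn f S) {k : ℂ} (hk : ∀ z ∈ S, Complex.exp (f z) = k) {x y : ℂ} (hx : x ∈ S)
    (hy : y ∈ S) : f x = f y := by
  have hk0 : k ≠ 0 := hk x hx ▸ Complex.exp_ne_zero _
  have hdisc : IsDiscrete (Complex.exp ⁻¹' {k}) :=
    isDiscrete_iff_discreteTopology.2 (Complex.isCoveringMapOn_exp k hk0).1
  exact hS.constant_of_mapsTo hdisc hf hk hx hy

/-- On a convex set a branch of `log (z - w)` changes by the principal logarithm of the quotient. -/
theorem Convex.sub_eq_log_div {S : Set ℂ} (hS : Convex ℝ S) {F : ℂ → ℂ} {w : ℂ}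
    (hF : ContinuousOn F S) (hexp : ∀ z ∈ S, Complex.exp (F z) = z - w) {x y : ℂ} (hx : x ∈ S)
    (hy : y ∈ S) : F y - F x = Complex.log ((y - w) / (x - w)) := by
  have hw : ∀ z ∈ S, z - w ≠ 0 := fun z hz => hexp z hz ▸ Complex.exp_ne_zero _
  have hwS : w ∉ S := fun h => hw w h (sub_self w)
  have hslit : ∀ z ∈ S, (z - w) / (x - w) ∈ Complex.slitPlane := fun z hz =>
    div_mem_slitPlane_of_notMem_segment fun h => hwS (hS.segment_subset hx hz h)
  have := hS.isPreconnected.eq_of_exp_eq (f := fun z => F z - Complex.log ((z - w) / (x - w)))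
    (hF.sub (ContinuousOn.clog (by fun_prop) hslit)) (k := x - w) (fun z hz => by
      rw [Complex.exp_sub, hexp z hz, Complex.exp_log (div_ne_zero (hw z hz) (hw x hx))]
      have := hw z hz
      have := hw x hx
      field_simp) hx hy
  simp only [div_self (hw x hx), Complex.log_one, sub_zero] at this
  rw [this]
  ring

/-- A branch of `log (z - w)` on `S` has a limit at `x ≠ w` if `S` is locally connected at `x`. -/
theorem exists_tendsto_of_exp_eq {S : Set ℂ} {F : ℂ → ℂ} {w x : ℂ} (hxw : x ≠ w)
    (hF : ContinuousOn F S) (hexp : ∀ z ∈ S, Complex.exp (F z) = z - w)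
    (hloc : ∀ R > 0, ∃ r > 0, r ≤ R ∧ IsPreconnected (S ∩ Metric.ball x r)) (hx : x ∈ closure S) :
    ∃ θ, Tendsto F (𝓝[S] x) (𝓝 θ) := by
  have hxw' : x - w ≠ 0 := sub_ne_zero.2 hxw
  obtain ⟨r, hr, hrR, hpre⟩ := hloc ‖x - w‖ (norm_pos_iff.2 hxw')
  have hslit : ∀ z ∈ Metric.ball x r, (z - w) / (x - w) ∈ Complex.slitPlane := by
    intro z hz
    have h1 : (z - w) / (x - w) = 1 + (z - x) / (x - w) := by field_simp; ring
    rw [h1]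
    refine Complex.mem_slitPlane_of_norm_lt_one ?_
    rw [norm_div, div_lt_one (norm_pos_iff.2 hxw'), ← dist_eq_norm]
    exact (Metric.mem_ball.1 hz).trans_le hrR
  obtain ⟨y, hyr, hyS⟩ := mem_closure_iff_nhds.1 hx _ (Metric.ball_mem_nhds x hr)
  have hconst : ∀ z ∈ S ∩ Metric.ball x r, F z - Complex.log ((z - w) / (x - w)) =
      F y - Complex.log ((y - w) / (x - w)) := fun z hz =>
    hpre.eq_of_exp_eq (f := fun z => F z - Complex.log ((z - w) / (x - w))) (k := x - w)
      ((hF.mono inter_subset_left).sub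
        (ContinuousOn.clog (by fun_prop) fun z hz => hslit z hz.2))
      (fun z hz => by
        have hz0 : z - w ≠ 0 := hexp z hz.1 ▸ Complex.exp_ne_zero _
        rw [Complex.exp_sub, hexp z hz.1, Complex.exp_log (div_ne_zero hz0 hxw')]
        field_simp) hz ⟨hyS, hyr⟩
  set c := F y - Complex.log ((y - w) / (x - w)) with hc
  have hlim : Tendsto (fun z => Complex.log ((z - w) / (x - w)) + c) (𝓝[S] x) (𝓝 (0 + c)) := by
    refine Tendsto.add_const _ ?_
    have : ContinuousAt (fun z => Complex.log ((z - w) / (x - w))) x :=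
      ContinuousAt.clog (by fun_prop) (hslit x (Metric.mem_ball_self hr))
    have h := this.tendsto.mono_left (nhdsWithin_le_nhds (s := S))
    simpa [div_self hxw'] using h
  refine ⟨_, hlim.congr' ?_⟩
  filter_upwards [inter_mem self_mem_nhdsWithin
    (mem_nhdsWithin_of_mem_nhds (Metric.ball_mem_nhds x hr))] with z hz
  rw [← hconst z hz]
  ring

end Logarithms

namespace StaggeredMesh
open Filter Topology

variable {Ω : Set ℂ} {I N E : Type*} [Fintype I] [Fintype N] [Fintype E]
  {M : StaggeredMesh Ω I N E}

/-! ### The domain near its boundary vertices -/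

theorem LeavesAt.dualEdge_subset {e : E} {i : I} {θ : ℝ} (h : M.LeavesAt e i θ) :
    M.dualEdge e ⊆ angleRay (M.center i) θ := by
  obtain ⟨j, -, hCE, hj⟩ := h
  rw [dualEdge_eq_segment hCE, segment_eq_image']
  rintro _ ⟨s, hs, rfl⟩
  refine ⟨s * ‖M.center j - M.center i‖, mul_nonneg hs.1 (norm_nonneg _), ?_⟩
  dsimp only
  rw [Complex.real_smul]
  push_cast
  rw [mul_assoc, ← hj]

theorem dualEdge_subset_closure_domain (M : StaggeredMesh Ω I N E) (e : E) :
    M.dualEdge e ⊆ closure Ω := by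
  obtain ⟨ν, hν⟩ := M.exists_mem_VE e
  exact (M.dualEdge_subset_frontier hν).trans
    (frontier_subset_closure.trans (closure_mono (M.dualCell_subset ν)))

theorem center_mem_closure_domain (M : StaggeredMesh Ω I N E) (i : I) :
    M.center i ∈ closure Ω :=
  closure_mono (M.cell_subset i) (M.center_mem i)

/-- The domain is locally connected at the centers of the primary cells: as the primary cells at
the boundary are simple polygons, at most two boundary edges meet in such a center, and the domain
lies on one side only of each. -/
theorem exists_isPreconnected_inter_ball (M : StaggeredMesh Ω I N E) (hΩ : IsOpen Ω) (i : I)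
    {R : ℝ} (hR : 0 < R) :
    ∃ r > 0, r ≤ R ∧ IsPreconnected (Ω ∩ Metric.ball (M.center i) r) := by
  by_cases hb : ∃ e ∈ M.bdryEdge, i ∈ M.CE e
  · obtain ⟨e₀, he₀, hi₀⟩ := hb
    have hfrcell : ∀ e ∈ M.bdryEdge, i ∈ M.CE e →
        segment ℝ (M.center i) (M.mid e) ⊆ frontier (M.cell i) := by
      intro e he hi
      rw [M.frontier_cell]
      exact (subset_biUnion_of_mem (u := fun e => segment ℝ (M.center i) (M.mid e))
        (show e ∈ {e | e ∈ M.EC i ∧ e ∈ M.bdryEdge} from ⟨M.mem_EC.2 hi, he⟩)).trans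
        subset_union_right
    obtain ⟨α, β, r₁, hr₁, hαβ, hβ, hfr⟩ :=
      (M.isPolygonalCell_cell i).exists_frontier_subset_angleRay
        (hfrcell e₀ he₀ hi₀ (left_mem_segment ℝ _ _))
    obtain ⟨r₀, hr₀, hnear⟩ := M.exists_ball_forall_mem_dualEdge i
    have hdir : ∀ e ∈ M.bdryEdge, i ∈ M.CE e → M.LeavesAt e i α ∨ M.LeavesAt e i β := by
      intro e he hi
      obtain ⟨j, hij, hCE⟩ := M.exists_CE_eq hi
      obtain ⟨t, ht0, ht1, hmid⟩ := exists_mid_eq hij hCE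
      have hlim : Tendsto (fun s : ℝ => M.center i + s * (M.mid e - M.center i)) (𝓝[>] 0)
          (𝓝 (M.center i)) := by
        have : Continuous (fun s : ℝ => M.center i + s * (M.mid e - M.center i)) := by fun_prop
        exact (this.tendsto' 0 _ (by simp)).mono_left nhdsWithin_le_nhds
      obtain ⟨s, hs1, hs2⟩ := ((hlim.eventually (Metric.ball_mem_nhds _ hr₁)).and
        (Ioc_mem_nhdsGT one_pos)).exists
      have hz : M.center i + s * (M.mid e - M.center i) ∈ segment ℝ (M.center i) (M.mid e) := by
        rw [segment_eq_image']
        exact ⟨s, ⟨hs2.1.le, hs2.2⟩, by simp⟩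
      have hze : M.center i + s * (M.mid e - M.center i) ∈ M.dualEdge e :=
        (convex_convexHull ℝ _).segment_subset (M.center_mem_dualEdge hi) (M.mid_mem_dualEdge e) hz
      have hne : M.center i + s * (M.mid e - M.center i) ≠ M.center i := by
        have := center_sub_center_ne_zero (M := M) hij
        simpa [hmid, hs2.1.ne', ht0.ne'] using this
      rcases hfr ⟨hfrcell e he hi hz, hs1⟩ with h | h
      · exact Or.inl (leavesAt_of_mem hi hze hne h)
      · exact Or.inr (leavesAt_of_mem hi hze hne h)
    set r := min r₀ R with hr
    have hr0 : 0 < r := lt_min hr₀ hR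
    have hfrΩ : frontier Ω ∩ Metric.ball (M.center i) r ⊆
        angleRay (M.center i) α ∪ angleRay (M.center i) β := by
      rintro z ⟨hz, hzr⟩
      rw [M.frontier_domain] at hz
      simp only [mem_iUnion, exists_prop] at hz
      obtain ⟨e, he, hze⟩ := hz
      have hi := hnear e z (Metric.ball_subset_ball (min_le_left _ _) hzr) hze
      exact (hdir e he hi).imp (fun h => h.dualEdge_subset hze) fun h => h.dualEdge_subset hze
    have hnot : ¬ Metric.ball (M.center i) r ⊆ closure Ω := by
      intro hsub
      obtain ⟨j, hij, hCE⟩ := M.exists_CE_eq hi₀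
      obtain ⟨ν, hν⟩ := M.exists_mem_VE e₀
      obtain ⟨κ, hκ0, hκ⟩ := exists_dualCenter_eq hij hCE hν
      obtain ⟨ε₀, hε₀, hdisj⟩ := exists_forall_disjoint_thinTriangle_dualEdge hij hCE
      obtain ⟨ε, hε, hκε⟩ : ∃ ε : ℝ, |ε| = ε₀ ∧ κ * ε < 0 := by
        rcases lt_or_gt_of_ne hκ0 with h | h
        · exact ⟨ε₀, abs_of_pos hε₀, mul_neg_of_neg_of_pos h hε₀⟩
        · exact ⟨-ε₀, by rw [abs_neg, abs_of_pos hε₀], by nlinarith⟩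
      have hne : ε ≠ 0 := by rintro rfl; simp at hκε
      have hd := disjoint_thinTriangle_closure_domain hΩ he₀ hij hCE hν hκ hκε
        (hdisj _ hne hε.le) (hdisj _ (neg_ne_zero.2 hne) (by rw [abs_neg, hε]))
      obtain ⟨z, hz1, hz2⟩ := mem_closure_iff_nhds.1
        (left_mem_closure_thinTriangle (M.center i) (M.center j) ε) _ (Metric.ball_mem_nhds _ hr0)
      exact disjoint_left.1 hd hz2 (hsub hz1)
    obtain ⟨α', β', -, -, -, hsec⟩ := exists_inter_ball_eq_sector hΩ hr0
      (M.center_mem_closure_domain i) hαβ hβ hfrΩ hnot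
    exact ⟨r, hr0, min_le_right _ _, hsec ▸ isPreconnected_sector _ _ _ _⟩
  · have hi : M.center i ∈ Ω := by
      by_contra hi
      have hfr : M.center i ∈ frontier Ω := by
        rw [hΩ.frontier_eq]; exact ⟨M.center_mem_closure_domain i, hi⟩
      rw [M.frontier_domain] at hfr
      simp only [mem_iUnion, exists_prop] at hfr
      obtain ⟨e, he, hmem⟩ := hfr
      exact hb ⟨e, he, M.mem_CE_of_center_mem_dualEdge hmem⟩
    obtain ⟨r, hr, hsub⟩ := Metric.isOpen_iff.1 hΩ _ hi
    refine ⟨min r R, lt_min hr hR, min_le_right _ _, ?_⟩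
    rw [inter_eq_right.2 ((Metric.ball_subset_ball (min_le_left _ _)).trans hsub)]
    exact (convex_ball _ _).isPreconnected

/-- Seen from a point outside a simply connected domain, the logarithmic increments along the dual
edges are the differences of a function of the vertices. -/
theorem exists_log_div_eq_sub (M : StaggeredMesh Ω I N E) (hΩ : IsOpen Ω)
    (hsc : IsSimplyConnected Ω) {w : ℂ} (hw : w ∉ closure Ω) :
    ∃ θ : I → ℂ, ∀ e i j, i ≠ j → (M.CE e : Set I) = {i, j} →
      Complex.log ((M.center j - w) / (M.center i - w)) = θ j - θ i := by
  obtain ⟨F, hF, hexp⟩ := Complex.exists_continuousOn_eqOn_exp_comp hsc hΩ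
    (g := fun z => z - w) (by fun_prop) (by
      rintro ⟨z, hz, h⟩
      exact hw (sub_eq_zero.1 h ▸ subset_closure hz))
  have hlim : ∀ i, ∃ θ, Tendsto F (𝓝[Ω] (M.center i)) (𝓝 θ) := fun i =>
    exists_tendsto_of_exp_eq (x := M.center i) (w := w)
      (fun h => hw (h ▸ M.center_mem_closure_domain i)) hF hexp
      (fun R hR => M.exists_isPreconnected_inter_ball hΩ i hR) (M.center_mem_closure_domain i)
  choose θ hθ using hlim
  refine ⟨θ, fun e i j hij hCE => ?_⟩
  obtain ⟨ν, hν⟩ := M.exists_mem_VE e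
  obtain ⟨κ, hκ0, hκ⟩ := exists_dualCenter_eq hij hCE hν
  obtain ⟨ε₀, hε₀, hdisj⟩ := exists_forall_disjoint_thinTriangle_dualEdge hij hCE
  obtain ⟨ε, hε, hκε⟩ : ∃ ε : ℝ, |ε| = ε₀ ∧ 0 < κ * ε := by
    rcases lt_or_gt_of_ne hκ0 with h | h
    · exact ⟨-ε₀, by rw [abs_neg, abs_of_pos hε₀], by nlinarith⟩
    · exact ⟨ε₀, abs_of_pos hε₀, mul_pos h hε₀⟩
  have hne : ε ≠ 0 := by rintro rfl; simp at hκε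
  set T := thinTriangle (M.center i) (M.center j) ε with hT
  have hTΩ : T ⊆ Ω := (thinTriangle_subset_dualCell hij hCE hν hκ hκε
    (hdisj _ hne hε.le)).1.trans (M.dualCell_subset ν)
  have := mem_closure_iff_nhdsWithin_neBot.1
    (left_mem_closure_thinTriangle (M.center i) (M.center j) ε)
  have := mem_closure_iff_nhdsWithin_neBot.1
    (right_mem_closure_thinTriangle (M.center i) (M.center j) ε)
  have h1 : Tendsto (fun p : ℂ × ℂ => F p.1 - F p.2)
      (𝓝[T] (M.center j) ×ˢ 𝓝[T] (M.center i)) (𝓝 (θ j - θ i)) :=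
    (((hθ j).mono_left (nhdsWithin_mono _ hTΩ)).comp tendsto_fst).sub
      (((hθ i).mono_left (nhdsWithin_mono _ hTΩ)).comp tendsto_snd)
  have hwi : M.center i - w ≠ 0 := sub_ne_zero.2 fun h => hw (h ▸ M.center_mem_closure_domain i)
  have h2 : Tendsto (fun p : ℂ × ℂ => Complex.log ((p.1 - w) / (p.2 - w)))
      (𝓝[T] (M.center j) ×ˢ 𝓝[T] (M.center i))
      (𝓝 (Complex.log ((M.center j - w) / (M.center i - w)))) := by
    refine Tendsto.clog ?_ ?_
    · have : ContinuousAt (fun p : ℂ × ℂ => (p.1 - w) / (p.2 - w)) (M.center j, M.center i) := by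
        fun_prop (disch := exact hwi)
      refine this.tendsto.mono_left ?_
      rw [nhds_prod_eq]
      exact Filter.prod_mono nhdsWithin_le_nhds nhdsWithin_le_nhds
    · refine div_mem_slitPlane_of_notMem_segment fun h => hw ?_
      rw [← dualEdge_eq_segment hCE] at h
      exact M.dualEdge_subset_closure_domain e h
  refine tendsto_nhds_unique (h2.congr' ?_) h1
  filter_upwards [prod_mem_prod self_mem_nhdsWithin self_mem_nhdsWithin] with p hp
  exact ((convex_thinTriangle _ _ _).sub_eq_log_div (hF.mono hTΩ)
    (fun z hz => hexp (hTΩ hz)) hp.2 hp.1).symm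

end StaggeredMesh

namespace StaggeredMesh
open Filter Topology

variable {Ω : Set ℂ} {I N E : Type*} [Fintype I] [Fintype N] [Fintype E]
  {M : StaggeredMesh Ω I N E}

/-! ### The winding potential of a circulation -/

/-- A choice of the first and last vertex of each dual edge, such that the dual edge `e` is directed
along the normal vector `n_e`. -/
structure IsOrientation (M : StaggeredMesh Ω I N E) (a b : E → I) : Prop where
  ne : ∀ e, a e ≠ b e
  CE_eq : ∀ e, (M.CE e : Set I) = {a e, b e}
  normalSign_left : ∀ e, M.normalSign e (a e) = 1

theorem exists_isOrientation (M : StaggeredMesh Ω I N E) : ∃ a b, M.IsOrientation a b := by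
  have h : ∀ e, ∃ i j, i ≠ j ∧ (M.CE e : Set I) = {i, j} ∧ M.normalSign e i = 1 := by
    intro e
    obtain ⟨i, j, hij, hCE, -⟩ := M.CE_spec e
    have hsum := normalSign_add_normalSign hij hCE
    by_cases h1 : M.normalSign e i = 1
    · exact ⟨i, j, hij, hCE, h1⟩
    · have h2 : M.normalSign e i = -1 := by
        rw [MeshData.normalSign] at h1 ⊢
        split_ifs at h1 ⊢ with h
        · exact absurd rfl h1
        · rfl
      exact ⟨j, i, hij.symm, by rw [hCE, pair_comm], by linarith⟩
  choose a b h1 h2 h3 using h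
  exact ⟨a, b, h1, h2, h3⟩

namespace IsOrientation

variable {a b : E → I}

theorem normalSign_right (h : M.IsOrientation a b) (e : E) : M.normalSign e (b e) = -1 := by
  have := normalSign_add_normalSign (h.ne e) (h.CE_eq e)
  rw [h.normalSign_left] at this
  linarith

/-- Summation by parts over the graph of dual edges. -/
theorem sum_mul_sub (h : M.IsOrientation a b) (f : E → ℝ) (g : I → ℂ) :
    ∑ e, (f e : ℂ) * (g (a e) - g (b e)) =
      ∑ i, g i * ((∑ e ∈ M.EC i, f e * M.normalSign e i : ℝ) : ℂ) := by
  classical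
  calc ∑ e, (f e : ℂ) * (g (a e) - g (b e))
      = ∑ e, ∑ i ∈ M.CE e, g i * (f e * M.normalSign e i : ℝ) := by
        refine Finset.sum_congr rfl fun e _ => ?_
        have : M.CE e = {a e, b e} := Finset.coe_injective (by simp [h.CE_eq e])
        rw [this, Finset.sum_pair (h.ne e), h.normalSign_left, h.normalSign_right]
        push_cast
        ring
    _ = ∑ e, ∑ i, if e ∈ M.EC i then g i * (f e * M.normalSign e i : ℝ) else 0 := by
        refine Finset.sum_congr rfl fun e _ => ?_
        rw [← Finset.sum_filter]
        exact Finset.sum_congr (by ext; simp [M.mem_EC]) fun _ _ => rfl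
    _ = ∑ i, g i * ((∑ e ∈ M.EC i, f e * M.normalSign e i : ℝ) : ℂ) := by
        rw [Finset.sum_comm]
        refine Finset.sum_congr rfl fun i _ => ?_
        rw [← Finset.sum_filter, Complex.ofReal_sum, Finset.mul_sum]
        exact Finset.sum_congr (by ext; simp) fun _ _ => rfl

end IsOrientation

/-- The potential at `z` of weights `f` on the directed dual edges. Its imaginary part is the sum of
the weighted angles under which the dual edges are seen from `z`; for a circulation this is `2π`
times the winding number around `z`. -/
noncomputable def windingPotential (M : StaggeredMesh Ω I N E) (a b : E → I) (f : E → ℝ) (z : ℂ) :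
    ℂ :=
  ∑ e, f e * Complex.log ((M.center (b e) - z) / (M.center (a e) - z))

namespace IsOrientation

variable {a b : E → I}

/-- The derivative of the potential is the sum of `div_i / (x_i - z)` over the vertices, after
summation by parts. -/
theorem hasDerivAt_windingPotential (h : M.IsOrientation a b) (f : E → ℝ)
    (hf : ∀ i, ∑ e ∈ M.EC i, f e * M.normalSign e i = 0) {z : ℂ} (hz : ∀ e, z ∉ M.dualEdge e) :
    HasDerivAt (M.windingPotential a b f) 0 z := by
  have hne : ∀ e, ∀ i ∈ M.CE e, M.center i - z ≠ 0 := fun e i hi h0 =>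
    hz e (sub_eq_zero.1 h0 ▸ M.center_mem_dualEdge hi)
  have hone : ∀ e, HasDerivAt
      (fun z => (f e : ℂ) * Complex.log ((M.center (b e) - z) / (M.center (a e) - z)))
      (f e * ((M.center (a e) - z)⁻¹ - (M.center (b e) - z)⁻¹)) z := by
    intro e
    have ha := hne e (a e) (Finset.mem_coe.1 (h.CE_eq e ▸ mem_insert _ _))
    have hb := hne e (b e)
      (Finset.mem_coe.1 (h.CE_eq e ▸ mem_insert_of_mem _ (mem_singleton _)))
    have hslit := div_mem_slitPlane_of_notMem_segment
      (by rw [← dualEdge_eq_segment (h.CE_eq e)]; exact hz e)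
    have hd := (((hasDerivAt_id z).const_sub (M.center (b e))).div
      ((hasDerivAt_id z).const_sub (M.center (a e))) ha).clog hslit
    refine (hd.const_mul (f e : ℂ)).congr_deriv ?_
    simp only [id, Pi.div_apply]
    field_simp
    ring
  have hsum := HasDerivAt.fun_sum fun e (_ : e ∈ Finset.univ) => hone e
  refine hsum.congr_deriv ?_
  rw [h.sum_mul_sub f fun i => (M.center i - z)⁻¹]
  simp [hf]

theorem windingPotential_eq_of_mem_dualCell (h : M.IsOrientation a b) (f : E → ℝ)
    (hf : ∀ i, ∑ e ∈ M.EC i, f e * M.normalSign e i = 0) {ν : N} {z z' : ℂ}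
    (hz : z ∈ M.dualCell ν) (hz' : z' ∈ M.dualCell ν) :
    M.windingPotential a b f z = M.windingPotential a b f z' := by
  have hcell := M.isPolygonalCell_dualCell ν
  have hd : ∀ z ∈ M.dualCell ν, HasDerivAt (M.windingPotential a b f) 0 z := fun z hz =>
    h.hasDerivAt_windingPotential f hf fun e he =>
      disjoint_left.1 (M.disjoint_dualEdge_dualCell e ν) he hz
  exact hcell.isOpen.is_const_of_deriv_eq_zero hcell.isConnected.isPreconnected
    (fun z hz => (hd z hz).differentiableAt.differentiableWithinAt)
    (fun z hz => (hd z hz).deriv) hz hz'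

/-- The potential of a circulation vanishes outside a simply connected domain. -/
theorem windingPotential_eq_zero (h : M.IsOrientation a b) (hΩ : IsOpen Ω)
    (hsc : IsSimplyConnected Ω) (f : E → ℝ)
    (hf : ∀ i, ∑ e ∈ M.EC i, f e * M.normalSign e i = 0) {w : ℂ} (hw : w ∉ closure Ω) :
    M.windingPotential a b f w = 0 := by
  obtain ⟨θ, hθ⟩ := M.exists_log_div_eq_sub hΩ hsc hw
  have h1 : M.windingPotential a b f w = -∑ e, (f e : ℂ) * (θ (a e) - θ (b e)) := by
    rw [windingPotential, ← Finset.sum_neg_distrib]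
    refine Finset.sum_congr rfl fun e _ => ?_
    rw [hθ e (a e) (b e) (h.ne e) (h.CE_eq e)]
    ring
  rw [h1, h.sum_mul_sub]
  simp [hf]

/-- The jump relation: the one-sided limits of the winding potential at the middle of the dual
edge `e` differ by `2πi f_e`. -/
theorem exists_tendsto_windingPotential (h : M.IsOrientation a b) (f : E → ℝ) (e : E) :
    ∃ c : ℂ, ∀ κ : ℝ, κ ≠ 0 →
      Tendsto (fun s : ℝ => M.windingPotential a b f
        (M.mid e + s * (κ * Complex.I * (M.center (b e) - M.center (a e))))) (𝓝[>] 0)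
        (𝓝 (c + f e * ((if 0 < κ then 1 else -1 : ℝ) * Real.pi * Complex.I))) := by
  classical
  obtain ⟨t, ht0, ht1, hmid⟩ := exists_mid_eq (h.ne e) (h.CE_eq e)
  have hv := center_sub_center_ne_zero (M := M) (h.ne e)
  set L : E → ℂ → ℂ := fun e z => Complex.log ((M.center (b e) - z) / (M.center (a e) - z)) with hL
  set q : ℂ := -(1 - t) / t with hq
  refine ⟨∑ e' ∈ Finset.univ.erase e, f e' * L e' (M.mid e) + f e * Real.log ‖q‖, fun κ hκ => ?_⟩
  set γ : ℝ → ℂ := fun s =>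
    M.mid e + s * (κ * Complex.I * (M.center (b e) - M.center (a e))) with hγ
  have hγlim : Tendsto γ (𝓝[>] 0) (𝓝 (M.mid e)) := by
    have : Continuous γ := by fun_prop
    exact (this.tendsto' 0 _ (by simp [hγ])).mono_left nhdsWithin_le_nhds
  have hother : Tendsto (fun s => ∑ e' ∈ Finset.univ.erase e, f e' * L e' (γ s)) (𝓝[>] 0)
      (𝓝 (∑ e' ∈ Finset.univ.erase e, f e' * L e' (M.mid e))) := by
    refine tendsto_finsetSum _ fun e' he' => Tendsto.const_mul _ ?_
    have hnot : M.mid e ∉ M.dualEdge e' := fun hm =>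
      (Finset.ne_of_mem_erase he') (M.mid_mem_dualEdge_iff.1 hm).symm
    have hne : M.center (a e') - M.mid e ≠ 0 := fun h0 => hnot (sub_eq_zero.1 h0 ▸
      M.center_mem_dualEdge (Finset.mem_coe.1 (h.CE_eq e' ▸ mem_insert _ _)))
    have hcont : ContinuousAt (L e') (M.mid e) := by
      refine ContinuousAt.clog (by fun_prop (disch := exact hne)) ?_
      refine div_mem_slitPlane_of_notMem_segment ?_
      rwa [← dualEdge_eq_segment (h.CE_eq e')]
    exact hcont.tendsto.comp hγlim
  -- the quotient of the edge itself crosses the negative real axis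
  have htc : (t : ℂ) ≠ 0 := Complex.ofReal_ne_zero.2 ht0.ne'
  have hquot : ∀ s : ℝ, (M.center (b e) - γ s) / (M.center (a e) - γ s) =
      ((-((1 - t) * t) + (s * κ) ^ 2) / (t ^ 2 + (s * κ) ^ 2) : ℝ) +
        (s * κ / (t ^ 2 + (s * κ) ^ 2) : ℝ) * Complex.I := by
    intro s
    have hden : t ^ 2 + (s * κ) ^ 2 ≠ 0 := by positivity
    have hdenc : (t ^ 2 + (s * κ) ^ 2 : ℂ) ≠ 0 := by exact_mod_cast hden
    have hfac : (t + s * κ * Complex.I) * (t - s * κ * Complex.I) = (t ^ 2 + (s * κ) ^ 2 : ℂ) := by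
      linear_combination -(s * κ : ℂ) ^ 2 * Complex.I_sq
    have hne : (t + s * κ * Complex.I : ℂ) ≠ 0 := left_ne_zero_of_mul (hfac ▸ hdenc)
    have h1 : M.center (b e) - γ s =
        (M.center (b e) - M.center (a e)) * (1 - t - s * κ * Complex.I) := by
      simp only [hγ, hmid]; ring
    have h2 : M.center (a e) - γ s =
        (M.center (b e) - M.center (a e)) * (-(t + s * κ * Complex.I)) := by
      simp only [hγ, hmid]; ring
    rw [h1, h2, mul_div_mul_left _ _ hv]
    push_cast
    rw [div_mul_eq_mul_div, ← add_div, div_eq_div_iff (neg_ne_zero.2 hne) hdenc]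
    linear_combination (s * κ : ℂ) ^ 2 * Complex.I_sq
  have hqlim : Tendsto (fun s => (M.center (b e) - γ s) / (M.center (a e) - γ s)) (𝓝[>] 0)
      (𝓝 q) := by
    have hne : M.center (a e) - M.mid e ≠ 0 := by
      rw [hmid]; simpa [ht0.ne'] using hv
    have hcont : ContinuousAt (fun z => (M.center (b e) - z) / (M.center (a e) - z)) (M.mid e) := by
      fun_prop (disch := exact hne)
    have hval : (M.center (b e) - M.mid e) / (M.center (a e) - M.mid e) = q := by
      rw [div_eq_iff hne, hmid, hq]; field_simp; ring
    rw [← hval]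
    exact hcont.tendsto.comp hγlim
  have hqr : q = ((-(1 - t) / t : ℝ) : ℂ) := by rw [hq]; push_cast; rfl
  have hre : q.re < 0 := by
    rw [hqr, Complex.ofReal_re]; exact div_neg_of_neg_of_pos (by linarith) ht0
  have him : q.im = 0 := by rw [hqr, Complex.ofReal_im]
  have himq : ∀ s : ℝ, ((M.center (b e) - γ s) / (M.center (a e) - γ s)).im =
      s * κ / (t ^ 2 + (s * κ) ^ 2) := by
    intro s
    rw [hquot]
    simp [-Complex.ofReal_div, -Complex.ofReal_mul, -Complex.ofReal_add, -Complex.ofReal_pow]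
  have hown : Tendsto (fun s => L e (γ s)) (𝓝[>] 0)
      (𝓝 (Real.log ‖q‖ + (if 0 < κ then 1 else -1 : ℝ) * Real.pi * Complex.I)) := by
    rcases lt_or_gt_of_ne hκ with hκ | hκ
    · rw [if_neg hκ.not_gt]
      have := (Complex.tendsto_log_nhdsWithin_im_neg_of_re_neg_of_im_zero hre him).comp
        (tendsto_nhdsWithin_iff.2 ⟨hqlim, by
          filter_upwards [self_mem_nhdsWithin] with s hs
          rw [himq]
          exact div_neg_of_neg_of_pos (mul_neg_of_pos_of_neg hs hκ) (by positivity)⟩)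
      rwa [Complex.ofReal_neg, Complex.ofReal_one, neg_one_mul, neg_mul, ← sub_eq_add_neg]
    · rw [if_pos hκ]
      have := (Complex.tendsto_log_nhdsWithin_im_nonneg_of_re_neg_of_im_zero hre him).comp
        (tendsto_nhdsWithin_iff.2 ⟨hqlim, by
          filter_upwards [self_mem_nhdsWithin] with s hs
          rw [himq]
          exact div_nonneg (mul_pos hs hκ).le (by positivity)⟩)
      rwa [Complex.ofReal_one, one_mul]
  have htot := hother.add (hown.const_mul (f e : ℂ))
  rw [mul_add, ← add_assoc] at htot
  refine htot.congr fun s => ?_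
  rw [windingPotential, ← Finset.sum_erase_add _ _ (Finset.mem_univ e)]

end IsOrientation

/-! ### Divergence-free fields are skew gradients -/

/-- The winding potential is constant on the dual cells, jumps by `2πi f_e` across the dual edge `e`
and vanishes outside the domain, so that its imaginary part gives the stream function. -/
theorem exists_eq_skewGradient (M : StaggeredMesh Ω I N E) (hΩ : IsOpen Ω)
    (hsc : IsSimplyConnected Ω) {u : M.VectorField} (hu : M.divergence u = 0) :
    ∃ ψ : M.DualScalarField, u = M.skewGradient ψ := by
  classical
  obtain ⟨a, b, h⟩ := M.exists_isOrientation
  set f : E → ℝ := fun e => u e * M.primaryLength e with hf_def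
  have hf : ∀ i, ∑ e ∈ M.EC i, f e * M.normalSign e i = 0 := (M.divergence_eq_zero_iff u).1 hu
  set W := M.windingPotential a b f with hW
  refine ⟨fun ν => -(W (M.dualCenter ν)).im / (2 * Real.pi), ?_⟩
  rw [eq_skewGradient_iff]
  intro e
  change f e = _
  obtain ⟨c, hc⟩ := h.exists_tendsto_windingPotential f e
  obtain ⟨ε₀, hε₀, hdisj⟩ := exists_forall_disjoint_thinTriangle_dualEdge (h.ne e) (h.CE_eq e)
  obtain ⟨t, ht0, ht1, hmid⟩ := exists_mid_eq (h.ne e) (h.CE_eq e)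
  have hπ := Real.pi_pos
  have hε : ∀ κ : ℝ, κ ≠ 0 → ∃ ε : ℝ, ε ≠ 0 ∧ |ε| = ε₀ ∧ 0 < κ * ε := by
    intro κ hκ0
    rcases lt_or_gt_of_ne hκ0 with h | h
    · exact ⟨-ε₀, by linarith, by rw [abs_neg, abs_of_pos hε₀], by nlinarith⟩
    · exact ⟨ε₀, hε₀.ne', abs_of_pos hε₀, mul_pos h hε₀⟩
  have hterm : ∀ ν ∈ M.VE e, ∀ κ : ℝ, κ ≠ 0 →
      M.dualCenter ν = M.mid e + κ * Complex.I * (M.center (b e) - M.center (a e)) →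
      (W (M.dualCenter ν)).im = c.im + f e * ((if 0 < κ then 1 else -1) * Real.pi) ∧
        M.tangentSign e ν = if 0 < κ then -1 else 1 := by
    intro ν hν κ hκ0 hκ
    constructor
    · obtain ⟨ε, hε0, hεε, hκε⟩ := hε κ hκ0
      have hside := (thinTriangle_subset_dualCell (h.ne e) (h.CE_eq e) hν hκ hκε
        (hdisj ε hε0 hεε.le)).2
      have hlim : Tendsto (fun s : ℝ => W (M.mid e +
          s * (κ * Complex.I * (M.center (b e) - M.center (a e))))) (𝓝[>] 0)
          (𝓝 (W (M.dualCenter ν))) := by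
        refine tendsto_const_nhds.congr' ?_
        filter_upwards [Ioc_mem_nhdsGT one_pos] with s hs
        exact h.windingPotential_eq_of_mem_dualCell f hf (M.dualCenter_mem ν) (hside s hs)
      rw [tendsto_nhds_unique hlim (hc κ hκ0)]
      split_ifs <;> simp
    · rw [← normalSign_mul_tangentSign (h.ne e) (h.CE_eq e) hκ0 hκ, h.normalSign_left, one_mul]
  by_cases he : e ∈ M.bdryEdge
  · obtain ⟨ν, hν⟩ := M.VE_bdry e he
    have hVE : M.VE e = {ν} := Finset.coe_injective (by simp [hν])
    have hmem : ν ∈ M.VE e := by simp [hVE]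
    obtain ⟨κ, hκ0, hκ⟩ := exists_dualCenter_eq (h.ne e) (h.CE_eq e) hmem
    obtain ⟨h1, h2⟩ := hterm ν hmem κ hκ0 hκ
    -- beyond the edge the potential vanishes
    obtain ⟨ε, hε0, hεε, hκε⟩ := hε (-κ) (neg_ne_zero.2 hκ0)
    have hout : Tendsto (fun s : ℝ => W (M.mid e +
        s * ((-κ : ℝ) * Complex.I * (M.center (b e) - M.center (a e))))) (𝓝[>] 0) (𝓝 0) := by
      refine tendsto_const_nhds.congr' ?_
      have hd := disjoint_thinTriangle_closure_domain hΩ he (h.ne e) (h.CE_eq e) hmem hκ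
        (by linarith) (hdisj ε hε0 hεε.le) (hdisj _ (neg_ne_zero.2 hε0) (by rw [abs_neg, hεε]))
      filter_upwards [eventually_mem_thinTriangle (M.center (a e)) (M.center (b e)) ht0 ht1 hκε]
        with s hs
      rw [← hmid] at hs
      exact (h.windingPotential_eq_zero hΩ hsc f hf (disjoint_left.1 hd hs)).symm
    have h3 := congrArg Complex.im (tendsto_nhds_unique hout (hc (-κ) (neg_ne_zero.2 hκ0)))
    rw [hVE, Finset.sum_singleton, h1, h2]
    rcases lt_or_gt_of_ne hκ0 with hκ' | hκ'
    · rw [if_pos (by linarith)] at h3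
      simp at h3
      rw [if_neg hκ'.not_gt, if_neg hκ'.not_gt]
      field_simp
      linarith
    · rw [if_neg (by linarith)] at h3
      simp at h3
      rw [if_pos hκ', if_pos hκ']
      field_simp
      linarith
  · obtain ⟨μ, ν, hμν, hset, hseg⟩ := M.VE_interior e he
    have hVE : M.VE e = {μ, ν} := Finset.coe_injective (by simp [hset])
    have hμ : μ ∈ M.VE e := by simp [hVE]
    have hν : ν ∈ M.VE e := by simp [hVE]
    obtain ⟨κ, hκ0, hκ⟩ := exists_dualCenter_eq (h.ne e) (h.CE_eq e) hμ
    obtain ⟨κ', hκ0', hκ'⟩ := exists_dualCenter_eq (h.ne e) (h.CE_eq e) hν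
    obtain ⟨h1, h2⟩ := hterm μ hμ κ hκ0 hκ
    obtain ⟨h3, h4⟩ := hterm ν hν κ' hκ0' hκ'
    -- the two dual centers lie on opposite sides
    have hopp : κ * κ' < 0 := by
      obtain ⟨p, q, hp, hq, hpq, hm⟩ := hseg
      have hpq' : (p + q : ℂ) = 1 := by exact_mod_cast hpq
      have h0 : (M.center (b e) - M.center (a e)) * ((p * κ + q * κ' : ℝ) * Complex.I) = 0 := by
        rw [hκ, hκ'] at hm
        simp only [Complex.real_smul] at hm
        push_cast
        linear_combination hm - M.mid e * hpq'
      have h5 := (mul_eq_zero.1 ((mul_eq_zero.1 h0).resolve_left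
        (center_sub_center_ne_zero (h.ne e)))).resolve_right Complex.I_ne_zero
      have h6 : p * κ + q * κ' = 0 := by exact_mod_cast h5
      have h7 : p * (κ * κ') = -(q * κ' ^ 2) := by linear_combination κ' * h6
      have h8 : 0 < q * κ' ^ 2 := by positivity
      by_contra hle
      have := mul_nonneg hp.le (not_lt.1 hle)
      linarith
    rw [hVE, Finset.sum_pair hμν, h1, h2, h3, h4]
    rcases mul_neg_iff.1 hopp with ⟨h5, h6⟩ | ⟨h5, h6⟩
    · rw [if_pos h5, if_pos h5, if_neg h6.not_gt, if_neg h6.not_gt]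
      field_simp
      ring
    · rw [if_pos h6, if_pos h6, if_neg h5.not_gt, if_neg h5.not_gt]
      field_simp
      ring

end StaggeredMesh

theorem mainTheorem8 {I N E : Type*} [Fintype I] [Fintype N] [Fintype E]
    (Ω : Set ℂ) (hΩ_open : IsOpen Ω) (hΩ_bounded : Bornology.IsBounded Ω)
    (hΩ_simplyConnected : IsSimplyConnected Ω)
    (M : StaggeredMesh Ω I N E) (u : M.VectorField) :
    M.divergence u = 0 ↔ ∃ ψ : M.DualScalarField, u = M.skewGradient ψ := by
  refine ⟨fun hu => M.exists_eq_skewGradient hΩ_open hΩ_simplyConnected hu, ?_⟩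
  rintro ⟨ψ, rfl⟩
  exact M.divergence_skewGradient ψ
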